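/- Let $\mathcal H=L^2(\mathbb R)$ be the Hilbert space of one oscillator in the Schrödinger representation, with $a=x+\tfrac12\frac{d}{dx}$ and $a^\dagger=x-\tfrac12\frac{d}{dx}$ on Schwartz functions (so $[a,a^\dagger]=1$), vacuum $|0\rangle=(2/\pi)^{1/4}e^{-x^2}$, number states $|n\rangle=(n!)^{-1/2}a^{\dagger n}|0\rangle$, and coherent states $|\alpha\rangle=e^{-|\alpha|^2/2}\sum_n\frac{\alpha^n}{\sqrt{n!}}|n\rangle$. Let $X_\varphi=\frac12(a^\dagger e^{i\varphi}+a e^{-i\varphi})$ be the quadratures, let $dE_\varphi(x)$ be the spectral measure of the self-adjoint closure of $X_\varphi$, and let $g(X_\varphi)=\int g(x)\,dE_\varphi(x)$. For $t,\varphi\in\mathbb R$ put $$F(t,\varphi)=\tfrac1{\sqrt{2\pi}}e^{-\frac12(t-2iX_\varphi)^2},\qquad G(t,\varphi)=\frac{d}{dt}\Big[t\,e^{t^2/2}\int_0^1 d\theta\,|i(1-\theta)te^{i\varphi}\rangle\langle -i\theta te^{i\varphi}|\Big].$$ For an operator $X$ whose domain contains the number states put $\mathrm{Tr}[G^\dagger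 X]=\sum_n\langle n|G^\dagger X|n\rangle$. The integrand $\theta\mapsto|i(1-\theta)te^{i\varphi}\rangle\langle -i\theta te^{i\varphi}|$ is integrable in operator norm, the bracket is differentiable in $t$ in operator norm, and the following holds. We say that $X=\int_0^\pi\frac{d\varphi}\pi\int_{-\infty}^\infty dt\,C(\varphi,t)\,F(t,\varphi)$ if: (i) for all $\varphi,x$ the integral $f_\varphi(x)=\int dt\,C(\varphi,t)\frac1{\sqrt{2\pi}}e^{-\frac12(t-2ix)^2}$ converges absolutely; (ii) for all $\varphi$ and all vectors $v$ in the range of $E_\varphi([-R,R])$ for some $R$, $v$ is in the domains of all $F(t,\varphi)$ and of $f_\varphi(X_\varphi)$, and $\int dt\,C(\varphi,t)F(t,\varphi)v=f_\varphi(X_\varphi)v$ as an absolutely convergent Bochner integral; (iii) for all $k,l$ $$\langle k|X|l\rangle=\int_0^\pi\frac{d\varphi}\pi\int f_\varphi(x)\,\langle k|dE_\varphi(x)|l\rangle ,$$ where, for each $\varphi$, the $x$-integral converges absolutely, and the $\varphi$-integral of the result over $[0,\pi]$ also converges absolutely. 1. For all $m,n\ge0$ and all $t,\varphi$, $$\mathrm{Tr}[G^\dagger(t,\varphi)\,a^{\dagger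 m}a^n]=\frac{d}{dt}\Big[t\int_0^1d\theta\,(-i\theta te^{i\varphi})^n(-i(1-\theta)te^{-i\varphi})^m\Big]$$ (the trace series converging), and, in the sense above, $$a^{\dagger m}a^n=\int_0^\pi\frac{d\varphi}\pi\int_{-\infty}^\infty dt\,\frac{d}{dt}\Big[t\int_0^1d\theta\,(-i\theta te^{i\varphi})^n(-i(1-\theta)te^{-i\varphi})^m\Big]F(t,\varphi).$$ 2. Let $X$ be any, possibly unbounded, operator whose domain contains the number states and which has a normal-ordered form $X=\sum_{m,n}c_{mn}a^{\dagger m}a^n$ (an identity of matrix elements between number states) with $$\sum_{m,n}|c_{mn}|\binom{m+n}{m}^{-1}\sqrt{(m+n)!}<\infty ;$$ this condition is automatic for polynomials in $a^\dagger,a$. Then the series $\mathrm{Tr}[G^\dagger(t,\varphi)X]$ converges absolutely for all $t,\varphi$, and, in the sense above, $$X=\int_0^\pi\frac{d\varphi}\pi\int_{-\infty}^\infty dt\,\mathrm{Tr}[G^\dagger(t,\varphi)X]\,F(t,\varphi).$$ 3. Equivalently, $W'_{\varphi,x}=\int dt\,\frac1{\sqrt{2\pi}}e^{-\frac12(t-2ix)^2}\,G^\dagger(t,\varphi)$,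 paired with $X$ by $\mathrm{Tr}[XW'_{\varphi,x}]:=\int dt\,\frac1{\sqrt{2\pi}}e^{-\frac12(t-2ix)^2}\,\mathrm{Tr}[G^\dagger(t,\varphi)X]$, is a dual of the quadrature spectral densities for these operators: for all $k,l$, $$\langle k|X|l\rangle=\int_0^\pi\frac{d\varphi}\pi\int\langle k|dE_\varphi(x)|l\rangle\,\mathrm{Tr}[XW'_{\varphi,x}].$$ -/

import Mathlib

open MeasureTheory
open scoped SchwartzMap

namespace Quadrature

/-! ## The oscillator in the Schrödinger representation -/

/-- The Hilbert space `L²(ℝ)` of one mode. -/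
abbrev Hilb : Type := Lp ℂ 2 (volume : Measure ℝ)

/-- A Schwartz function as a vector of `L²(ℝ)`. -/
noncomputable def ket (f : 𝓢(ℝ, ℂ)) : Hilb := f.toLp 2 volume

/-- Multiplication by the coordinate `x`. -/
noncomputable def position : 𝓢(ℝ, ℂ) →L[ℂ] 𝓢(ℝ, ℂ) :=
  SchwartzMap.smulLeftCLM ℂ (fun x : ℝ => (x : ℂ))

theorem position_apply (f : 𝓢(ℝ, ℂ)) (x : ℝ) : position f x = (x : ℂ) * f x := by
  unfold position
  rw [SchwartzMap.smulLeftCLM_apply_apply (by fun_prop), smul_eq_mul]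

/-- The annihilation operator `a = x + ½ d/dx`. -/
noncomputable def annihilation : 𝓢(ℝ, ℂ) →L[ℂ] 𝓢(ℝ, ℂ) :=
  position + (1 / 2 : ℂ) • SchwartzMap.derivCLM ℂ ℂ

/-- The creation operator `a† = x - ½ d/dx`. -/
noncomputable def creation : 𝓢(ℝ, ℂ) →L[ℂ] 𝓢(ℝ, ℂ) :=
  position - (1 / 2 : ℂ) • SchwartzMap.derivCLM ℂ ℂ

/-- The quadrature `X_φ = ½ (a† e^{iφ} + a e^{-iφ})`. -/
noncomputable def quadrature (φ : ℝ) : 𝓢(ℝ, ℂ) →L[ℂ] 𝓢(ℝ, ℂ) :=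
  (1 / 2 : ℂ) • (Complex.exp (Complex.I * φ) • creation
    + Complex.exp (-(Complex.I * φ)) • annihilation)

theorem iteratedDeriv_gauss (n : ℕ) : ∃ p : Polynomial ℝ,
    iteratedDeriv n (fun x : ℝ => Real.exp (-x ^ 2)) = fun x => p.eval x * Real.exp (-x ^ 2) := by
  induction n with
  | zero => exact ⟨1, by simp⟩
  | succ n ih =>
    obtain ⟨p, hp⟩ := ih
    refine ⟨p.derivative - 2 * Polynomial.X * p, ?_⟩
    rw [iteratedDeriv_succ, hp]
    funext x
    have h1 : HasDerivAt (fun x : ℝ => Real.exp (-x ^ 2)) (Real.exp (-x ^ 2) * (-(2 * x))) x := by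
      have := ((hasDerivAt_pow 2 x).neg).exp
      simpa using! this
    have h2 := ((p.hasDerivAt x).mul h1).deriv
    have h3 : deriv (fun x => p.eval x * Real.exp (-x ^ 2)) x = _ := h2
    rw [h3]
    simp
    ring

theorem gauss_decay (p : Polynomial ℝ) (k : ℕ) :
    ∃ C, ∀ x : ℝ, |x| ^ k * |p.eval x * Real.exp (-x ^ 2)| ≤ C := by
  induction p using Polynomial.induction_on' with
  | add p q hp hq =>
    obtain ⟨C, hC⟩ := hp
    obtain ⟨D, hD⟩ := hq
    refine ⟨C + D, fun x => ?_⟩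
    have h := abs_add_le (p.eval x * Real.exp (-x ^ 2)) (q.eval x * Real.exp (-x ^ 2))
    rw [Polynomial.eval_add, add_mul]
    calc _ ≤ |x| ^ k * (|p.eval x * Real.exp (-x ^ 2)| + |q.eval x * Real.exp (-x ^ 2)|) := by
          gcongr
      _ ≤ C + D := by rw [mul_add]; exact add_le_add (hC x) (hD x)
  | monomial n c =>
    refine ⟨|c| * ((k + n).factorial * Real.exp 1), fun x => ?_⟩
    have h1 : |x| ^ (k + n) ≤ (k + n).factorial * Real.exp |x| := by
      have := Real.pow_div_factorial_le_exp |x| (abs_nonneg x) (k + n)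
      rwa [div_le_iff₀ (by positivity), mul_comm] at this
    have h2 : Real.exp |x| * Real.exp (-x ^ 2) ≤ Real.exp 1 := by
      rw [← Real.exp_add]
      apply Real.exp_le_exp.2
      nlinarith [sq_nonneg (|x| - 1), sq_abs x, sq_nonneg (|x| - 1 / 2)]
    rw [Polynomial.eval_monomial, abs_mul, abs_mul, abs_pow, Real.abs_exp]
    calc _ = |c| * (|x| ^ (k + n) * Real.exp (-x ^ 2)) := by rw [pow_add]; ring
      _ ≤ |c| * ((k + n).factorial * Real.exp |x| * Real.exp (-x ^ 2)) := by gcongr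
      _ = |c| * ((k + n).factorial * (Real.exp |x| * Real.exp (-x ^ 2))) := by ring
      _ ≤ _ := by gcongr

/-- The function `e^{-x²}` as a Schwartz function. -/
noncomputable def gauss : 𝓢(ℝ, ℝ) where
  toFun x := Real.exp (-x ^ 2)
  smooth' := by fun_prop
  decay' := by
    intro k n
    obtain ⟨p, hp⟩ := iteratedDeriv_gauss n
    obtain ⟨C, hC⟩ := gauss_decay p k
    refine ⟨C, fun x => ?_⟩
    rw [norm_iteratedFDeriv_eq_norm_iteratedDeriv, hp, Real.norm_eq_abs, Real.norm_eq_abs]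
    exact hC x

/-- The vacuum `(2/π)^{1/4} e^{-x²}`, the normalized solution of `a f = 0`. -/
noncomputable def vacuum : 𝓢(ℝ, ℂ) :=
  (((2 / Real.pi) ^ (1 / 4 : ℝ) : ℝ) : ℂ) • gauss.postcompCLM Complex.ofRealCLM

/-- The number state `|n⟩ = (n!)^{-1/2} a†ⁿ |0⟩`, as a Schwartz function. -/
noncomputable def fock (n : ℕ) : 𝓢(ℝ, ℂ) :=
  ((Real.sqrt n.factorial : ℝ) : ℂ)⁻¹ • (creation ^ n) vacuum

/-- The number state `|n⟩` as a vector of the Hilbert space. -/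
noncomputable def fockKet (n : ℕ) : Hilb := ket (fock n)

/-- The coherent state `|α⟩ = e^{-|α|²/2} ∑ₙ αⁿ/√n! |n⟩`. -/
noncomputable def coherent (α : ℂ) : Hilb :=
  ((Real.exp (-‖α‖ ^ 2 / 2) : ℝ) : ℂ) •
    ∑' n : ℕ, (α ^ n / ((Real.sqrt n.factorial : ℝ) : ℂ)) • fockKet n

/-! ## Spectral representation and functional calculus of the quadratures

For `sin φ ≠ 0` one has `X_φ = M⁻¹ (sin φ · P) M`, where `P = -(i/2) d/dx` and `M` is the
multiplication by `e^{i cot φ x²}`; the Fourier transform turns `P` into the multiplication by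
`π ξ`. For `sin φ = 0` the operator `X_φ = cos φ · x` is a multiplication operator already. -/

theorem memLp_chirp (s : ℝ) (v : Hilb) :
    MemLp (fun x : ℝ => Complex.exp (((s * x ^ 2 : ℝ) : ℂ) * Complex.I) * v x) 2 volume := by
  refine (Lp.memLp v).of_le ?_ ?_
  · refine AEStronglyMeasurable.mul ?_ (Lp.memLp v).1
    exact Continuous.aestronglyMeasurable (by fun_prop)
  · refine Filter.Eventually.of_forall fun x => ?_
    rw [norm_mul, Complex.norm_exp_ofReal_mul_I, one_mul]

/-- Multiplication by `e^{isx²}` on `L²(ℝ)`. -/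
noncomputable def chirpFun (s : ℝ) (v : Hilb) : Hilb := (memLp_chirp s v).toLp

theorem coeFn_chirpFun (s : ℝ) (v : Hilb) :
    chirpFun s v =ᵐ[volume]
      fun x : ℝ => Complex.exp (((s * x ^ 2 : ℝ) : ℂ) * Complex.I) * v x :=
  (memLp_chirp s v).coeFn_toLp

theorem chirpFun_neg (s : ℝ) (v : Hilb) : chirpFun (-s) (chirpFun s v) = v := by
  apply Lp.ext
  filter_upwards [coeFn_chirpFun (-s) (chirpFun s v), coeFn_chirpFun s v] with x h1 h2
  rw [h1, h2, ← mul_assoc, ← Complex.exp_add]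
  simp

/-- Multiplication by `e^{isx²}` as a unitary of `L²(ℝ)`. -/
noncomputable def chirp (s : ℝ) : Hilb ≃ₗᵢ[ℂ] Hilb where
  toFun := chirpFun s
  invFun := chirpFun (-s)
  left_inv := chirpFun_neg s
  right_inv v := by simpa using chirpFun_neg (-s) v
  map_add' u v := by
    apply Lp.ext
    filter_upwards [coeFn_chirpFun s (u + v), coeFn_chirpFun s u, coeFn_chirpFun s v,
      Lp.coeFn_add u v, Lp.coeFn_add (chirpFun s u) (chirpFun s v)] with x h1 h2 h3 h4 h5
    rw [h1, h4, h5, Pi.add_apply, Pi.add_apply, h2, h3, mul_add]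
  map_smul' c v := by
    apply Lp.ext
    filter_upwards [coeFn_chirpFun s (c • v), coeFn_chirpFun s v,
      Lp.coeFn_smul c v, Lp.coeFn_smul c (chirpFun s v)] with x h1 h2 h3 h4
    rw [RingHom.id_apply, h1, h3, h4, Pi.smul_apply, Pi.smul_apply, h2, smul_eq_mul, smul_eq_mul]
    ring
  norm_map' v := by
    change ‖chirpFun s v‖ = ‖v‖
    rw [Lp.norm_def, Lp.norm_def]
    congr 1
    apply eLpNorm_congr_norm_ae
    filter_upwards [coeFn_chirpFun s v] with x h1
    rw [h1, norm_mul, Complex.norm_exp_ofReal_mul_I, one_mul]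

/-- The unitary `V_φ` onto the spectral representation of `X_φ`. -/
noncomputable def spectralRep (φ : ℝ) : Hilb ≃ₗᵢ[ℂ] Hilb :=
  if Real.sin φ = 0 then LinearIsometryEquiv.refl ℂ Hilb
  else (chirp (Real.cos φ / Real.sin φ)).trans (Lp.fourierTransformₗᵢ ℝ ℂ)

/-- The real function by which `V_φ X_φ V_φ⁻¹` multiplies. -/
noncomputable def spectralVar (φ ξ : ℝ) : ℝ :=
  if Real.sin φ = 0 then Real.cos φ * ξ else Real.pi * Real.sin φ * ξ

/-- The domain of `g(X_φ)`. -/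
def funcDomain (φ : ℝ) (g : ℝ → ℂ) : Submodule ℂ Hilb where
  carrier := {v | MemLp (fun ξ : ℝ => g (spectralVar φ ξ) * spectralRep φ v ξ) 2 volume}
  zero_mem' := by
    refine (memLp_congr_ae ?_).2 (MemLp.zero' (ε := ℂ) (p := 2) (μ := (volume : Measure ℝ)))
    rw [map_zero]
    filter_upwards [Lp.coeFn_zero ℂ 2 (volume : Measure ℝ)] with ξ h
    rw [h, Pi.zero_apply, mul_zero]
  add_mem' := by
    intro u v hu hv
    refine (memLp_congr_ae ?_).2 (hu.add hv)
    rw [map_add]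
    filter_upwards [Lp.coeFn_add (spectralRep φ u) (spectralRep φ v)] with ξ h
    rw [h, Pi.add_apply, Pi.add_apply, mul_add]
  smul_mem' := by
    intro c v hv
    refine (memLp_congr_ae ?_).2 (hv.const_smul c)
    rw [map_smul]
    filter_upwards [Lp.coeFn_smul c (spectralRep φ v)] with ξ h
    rw [h, Pi.smul_apply, Pi.smul_apply, smul_eq_mul, smul_eq_mul]
    ring

/-- The operator `g(X_φ) = V_φ⁻¹ (multiplication by g(spectralVar φ ·)) V_φ` with its maximal
domain, that is `∫ g(x) dE_φ(x)`; in particular `E_φ(B) = 1_B(X_φ)`. -/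
noncomputable def funcCalc (φ : ℝ) (g : ℝ → ℂ) : Hilb →ₗ.[ℂ] Hilb where
  domain := funcDomain φ g
  toFun :=
    { toFun := fun v => (spectralRep φ).symm (MemLp.toLp _ v.2)
      map_add' := by
        intro u v
        rw [← map_add]
        congr 1
        apply Lp.ext
        filter_upwards [MemLp.coeFn_toLp (u + v).2, MemLp.coeFn_toLp u.2, MemLp.coeFn_toLp v.2,
          Lp.coeFn_add (MemLp.toLp _ u.2) (MemLp.toLp _ v.2),
          Lp.coeFn_add (spectralRep φ u.1) (spectralRep φ v.1)] with ξ h1 h2 h3 h4 h5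
        rw [h1, h4, Pi.add_apply, h2, h3, Submodule.coe_add, map_add, h5, Pi.add_apply, mul_add]
      map_smul' := by
        intro c v
        rw [RingHom.id_apply, ← map_smul]
        congr 1
        apply Lp.ext
        filter_upwards [MemLp.coeFn_toLp (c • v).2, MemLp.coeFn_toLp v.2,
          Lp.coeFn_smul c (MemLp.toLp _ v.2),
          Lp.coeFn_smul c (spectralRep φ v.1)] with ξ h1 h2 h3 h4
        rw [h1, h3, Pi.smul_apply, h2, Submodule.coe_smul, map_smul, h4, Pi.smul_apply,
          smul_eq_mul, smul_eq_mul]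
        ring }

theorem iteratedDeriv_phase (n : ℕ) :
    iteratedDeriv n (fun y : ℝ => Complex.exp ((y : ℂ) * Complex.I)) =
      fun y : ℝ => Complex.I ^ n * Complex.exp ((y : ℂ) * Complex.I) := by
  induction n with
  | zero => simp
  | succ n ih =>
    rw [iteratedDeriv_succ, ih]
    funext y
    have h1 : HasDerivAt (fun y : ℝ => (y : ℂ) * Complex.I) (1 * Complex.I) y :=
      (Complex.ofRealCLM.hasDerivAt (x := y)).mul_const Complex.I
    rw [(h1.cexp.const_mul (Complex.I ^ n)).deriv]
    ring

theorem hasTemperateGrowth_chirp (s : ℝ) : Function.HasTemperateGrowth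
    (fun x : ℝ => Complex.exp (((s * x ^ 2 : ℝ) : ℂ) * Complex.I)) := by
  have h1 : Function.HasTemperateGrowth (fun y : ℝ => Complex.exp ((y : ℂ) * Complex.I)) := by
    refine ⟨(Complex.ofRealCLM.contDiff.mul contDiff_const).cexp, fun n => ⟨0, 1, fun x => ?_⟩⟩
    rw [norm_iteratedFDeriv_eq_norm_iteratedDeriv, iteratedDeriv_phase]
    simp [Complex.norm_exp_ofReal_mul_I]
  have h2 : Function.HasTemperateGrowth (fun x : ℝ => s * x ^ 2) := by
    fun_prop
  exact h1.comp h2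

theorem quadrature_apply (φ : ℝ) (f : 𝓢(ℝ, ℂ)) (x : ℝ) :
    quadrature φ f x = (Real.cos φ : ℂ) * (x : ℂ) * f x
      - Complex.I / 2 * (Real.sin φ : ℂ) * deriv f x := by
  have hc : Complex.exp (Complex.I * φ) = Complex.cos φ + Complex.sin φ * Complex.I := by
    rw [mul_comm, Complex.exp_mul_I]
  have hd : Complex.exp (-(Complex.I * φ)) = Complex.cos φ - Complex.sin φ * Complex.I := by
    have : -(Complex.I * (φ : ℂ)) = (-(φ : ℂ)) * Complex.I := by ring
    rw [this, Complex.exp_mul_I, Complex.cos_neg, Complex.sin_neg]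
    ring
  simp only [quadrature, creation, annihilation, smul_apply, add_apply, sub_apply,
    SchwartzMap.derivCLM_apply, position_apply, smul_eq_mul, hc, hd, Complex.ofReal_cos, Complex.ofReal_sin]
  ring

/-- `V_φ` carries `X_φ` into the multiplication by `spectralVar φ`. -/
theorem spectralRep_quadrature (φ : ℝ) (f : 𝓢(ℝ, ℂ)) :
    spectralRep φ (ket (quadrature φ f)) =ᵐ[volume]
      fun ξ => (spectralVar φ ξ : ℂ) * spectralRep φ (ket f) ξ := by
  by_cases hs : Real.sin φ = 0
  · simp only [spectralRep, spectralVar, hs, if_true, LinearIsometryEquiv.coe_refl, id]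
    filter_upwards [SchwartzMap.coeFn_toLp (quadrature φ f) 2 volume,
      SchwartzMap.coeFn_toLp f 2 volume] with ξ h1 h2
    unfold ket
    rw [h1, h2, quadrature_apply, hs]
    push_cast
    ring
  · set c : ℝ := Real.cos φ / Real.sin φ with hc
    have key : ∀ g : 𝓢(ℝ, ℂ), spectralRep φ (ket g) =
        (FourierTransform.fourier (SchwartzMap.smulLeftCLM ℂ
          (fun x : ℝ => Complex.exp (((c * x ^ 2 : ℝ) : ℂ) * Complex.I)) g)).toLp 2 volume := by
      intro g
      rw [← SchwartzMap.toLp_fourier_eq]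
      simp only [spectralRep, hs, if_false, LinearIsometryEquiv.trans_apply]
      change Lp.fourierTransformₗᵢ ℝ ℂ (chirpFun c (ket g)) = Lp.fourierTransformₗᵢ ℝ ℂ _
      congr 1
      apply Lp.ext
      filter_upwards [coeFn_chirpFun c (ket g), SchwartzMap.coeFn_toLp g 2 volume,
        SchwartzMap.coeFn_toLp (SchwartzMap.smulLeftCLM ℂ
          (fun x : ℝ => Complex.exp (((c * x ^ 2 : ℝ) : ℂ) * Complex.I)) g) 2 volume]
        with x h1 h2 h3
      rw [h1, h3, SchwartzMap.smulLeftCLM_apply_apply (hasTemperateGrowth_chirp c), smul_eq_mul]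
      unfold ket
      rw [h2]
    set h : 𝓢(ℝ, ℂ) := SchwartzMap.smulLeftCLM ℂ
      (fun x : ℝ => Complex.exp (((c * x ^ 2 : ℝ) : ℂ) * Complex.I)) f with hh
    have hcs : (Real.sin φ : ℂ) * (c : ℂ) = (Real.cos φ : ℂ) := by
      rw [hc]
      push_cast
      have : (Complex.sin φ : ℂ) ≠ 0 := by exact_mod_cast hs
      field_simp
    have hM : SchwartzMap.smulLeftCLM ℂ
        (fun x : ℝ => Complex.exp (((c * x ^ 2 : ℝ) : ℂ) * Complex.I)) (quadrature φ f) =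
        (-(Complex.I / 2 * (Real.sin φ : ℂ))) • SchwartzMap.derivCLM ℂ ℂ h := by
      ext x
      rw [SchwartzMap.smulLeftCLM_apply_apply (hasTemperateGrowth_chirp c), quadrature_apply,
        smul_apply, SchwartzMap.derivCLM_apply, smul_eq_mul, smul_eq_mul]
      have e : (h : ℝ → ℂ) = fun x : ℝ =>
          Complex.exp (((c * x ^ 2 : ℝ) : ℂ) * Complex.I) * f x := by
        funext y
        rw [hh, SchwartzMap.smulLeftCLM_apply_apply (hasTemperateGrowth_chirp c), smul_eq_mul]
      have d1 : HasDerivAt (fun x : ℝ => ((c * x ^ 2 : ℝ) : ℂ) * Complex.I)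
          (((c * (2 * x) : ℝ) : ℂ) * Complex.I) x := by
        have := ((hasDerivAt_pow 2 x).const_mul c).ofReal_comp.mul_const Complex.I
        simpa using this
      have d2 : deriv (fun x : ℝ => Complex.exp (((c * x ^ 2 : ℝ) : ℂ) * Complex.I) * f x) x = _ :=
        (d1.cexp.mul (f.hasDerivAt x)).deriv
      rw [e, d2, ← hcs]
      push_cast
      linear_combination (Complex.exp ((c : ℂ) * (x : ℂ) ^ 2 * Complex.I) * f x *
        Complex.sin φ * c * x) * Complex.I_sq
    rw [key, key, hM]
    filter_upwards [SchwartzMap.coeFn_toLp (FourierTransform.fourier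
        ((-(Complex.I / 2 * (Real.sin φ : ℂ))) • SchwartzMap.derivCLM ℂ ℂ h)) 2 volume,
      SchwartzMap.coeFn_toLp (FourierTransform.fourier h) 2 volume] with ξ h1 h2
    rw [h1, h2, FourierTransform.fourier_smul, smul_apply, smul_eq_mul,
      SchwartzMap.fourier_coe, SchwartzMap.fourier_coe]
    have h3 : ((SchwartzMap.derivCLM ℂ ℂ h : 𝓢(ℝ, ℂ)) : ℝ → ℂ) = deriv h := by
      funext x
      rw [SchwartzMap.derivCLM_apply]
    rw [h3, Real.fourier_deriv h.integrable h.differentiable (by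
      rw [← h3]; exact SchwartzMap.integrable _)]
    simp only [spectralVar, hs, if_false, smul_eq_mul]
    push_cast
    linear_combination (-(Complex.sin φ * Real.pi * ξ * FourierTransform.fourier (h : ℝ → ℂ) ξ))
      * Complex.I_sq

/-- The sesquilinear form `⟨u| g(X_φ) |v⟩ = ∫ g(x) ⟨u| dE_φ(x) |v⟩`. -/
noncomputable def spectralForm (φ : ℝ) (g : ℝ → ℂ) (u v : Hilb) : ℂ :=
  ∫ ξ : ℝ, (starRingEnd ℂ) (spectralRep φ u ξ) * (g (spectralVar φ ξ) * spectralRep φ v ξ)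

/-- Absolute convergence of `∫ g(x) ⟨u| dE_φ(x) |v⟩`. -/
def SpectralFormConverges (φ : ℝ) (g : ℝ → ℂ) (u v : Hilb) : Prop :=
  Integrable (fun ξ : ℝ =>
    (starRingEnd ℂ) (spectralRep φ u ξ) * (g (spectralVar φ ξ) * spectralRep φ v ξ)) volume

/-- `v` belongs to the range of the spectral projection `E_φ([-R, R])`. -/
def SpectrallyBounded (φ R : ℝ) (v : Hilb) : Prop :=
  ∀ᵐ ξ : ℝ, R < |spectralVar φ ξ| → spectralRep φ v ξ = 0

/-! ## The operators `F(t,φ)` and `G(t,φ)` -/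

/-- The function `(2π)^{-1/2} exp(-½ (t - 2ix)²)`. -/
noncomputable def gaussKernel (t x : ℝ) : ℂ :=
  (((Real.sqrt (2 * Real.pi))⁻¹ : ℝ) : ℂ) *
    Complex.exp (-(1 / 2) * ((t : ℂ) - 2 * Complex.I * x) ^ 2)

/-- `F(t,φ) = (2π)^{-1/2} exp(-½ (t - 2i X_φ)²)`, an unbounded operator. -/
noncomputable def opF (t φ : ℝ) : Hilb →ₗ.[ℂ] Hilb := funcCalc φ (gaussKernel t)

/-- The rank-one operator `|i(1-θ)te^{iφ}⟩⟨-iθte^{iφ}|`. -/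
noncomputable def coherentDyad (φ t θ : ℝ) : Hilb →L[ℂ] Hilb :=
  InnerProductSpace.rankOne ℂ
    (coherent (Complex.I * (1 - θ) * t * Complex.exp (Complex.I * φ)))
    (coherent (-Complex.I * θ * t * Complex.exp (Complex.I * φ)))

/-- `t e^{t²/2} ∫₀¹ |i(1-θ)te^{iφ}⟩⟨-iθte^{iφ}| dθ`. -/
noncomputable def primitiveG (φ t : ℝ) : Hilb →L[ℂ] Hilb :=
  ((t * Real.exp (t ^ 2 / 2) : ℝ) : ℂ) • ∫ θ in (0 : ℝ)..1, coherentDyad φ t θ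

/-- `G(t,φ) = d/dt (t e^{t²/2} ∫₀¹ |i(1-θ)te^{iφ}⟩⟨-iθte^{iφ}| dθ)`, the derivative being taken
in operator norm. -/
noncomputable def opG (t φ : ℝ) : Hilb →L[ℂ] Hilb := deriv (primitiveG φ) t

/-! ## Operators with a normal-ordered form -/

/-- The number states belong to the domain of `X`. -/
def DefinedOnFock (X : Hilb →ₗ.[ℂ] Hilb) : Prop := ∀ n, fockKet n ∈ X.domain

/-- The `n`-th term `⟨n| A† X |n⟩` of the trace `Tr[A† X]`. -/
noncomputable def traceTerm (A : Hilb →L[ℂ] Hilb) (X : Hilb →ₗ.[ℂ] Hilb) (hX : DefinedOnFock X)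
    (n : ℕ) : ℂ :=
  inner ℂ (fockKet n) (ContinuousLinearMap.adjoint A (X ⟨fockKet n, hX n⟩))

/-- `Tr[A† X] = ∑ₙ ⟨n| A† X |n⟩`. -/
noncomputable def traceAdj (A : Hilb →L[ℂ] Hilb) (X : Hilb →ₗ.[ℂ] Hilb) (hX : DefinedOnFock X) :
    ℂ :=
  ∑' n, traceTerm A X hX n

/-- `X = ∑ c_{mn} a†ᵐ aⁿ`, as an identity between matrix elements in the number basis (for each
of which only finitely many terms of the sum do not vanish). -/
def HasNormalOrderedForm (X : Hilb →ₗ.[ℂ] Hilb) (hX : DefinedOnFock X) (c : ℕ → ℕ → ℂ) : Prop :=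
  ∀ k l : ℕ, HasSum
    (fun p : ℕ × ℕ => c p.1 p.2 *
      inner ℂ (fockKet k) (ket ((creation ^ p.1) ((annihilation ^ p.2) (fock l)))))
    (inner ℂ (fockKet k) (X ⟨fockKet l, hX l⟩))

theorem ket_injective : Function.Injective (SchwartzMap.toLpCLM ℂ ℂ 2 (volume : Measure ℝ) :
    𝓢(ℝ, ℂ) →L[ℂ] Hilb) :=
  SchwartzMap.injective_toLp 2 volume

/-- The operator `a†ᵐ aⁿ` with the Schwartz space as its domain. -/
noncomputable def normalMonomial (m n : ℕ) : Hilb →ₗ.[ℂ] Hilb where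
  domain := LinearMap.range
    (SchwartzMap.toLpCLM ℂ ℂ 2 (volume : Measure ℝ) : 𝓢(ℝ, ℂ) →L[ℂ] Hilb).toLinearMap
  toFun := (SchwartzMap.toLpCLM ℂ ℂ 2 (volume : Measure ℝ)).toLinearMap ∘ₗ
    ((creation ^ m) * (annihilation ^ n)).toLinearMap ∘ₗ
    (LinearEquiv.ofInjective
      (SchwartzMap.toLpCLM ℂ ℂ 2 (volume : Measure ℝ) : 𝓢(ℝ, ℂ) →L[ℂ] Hilb).toLinearMap
      ket_injective).symm.toLinearMap

theorem definedOnFock_normalMonomial (m n : ℕ) : DefinedOnFock (normalMonomial m n) :=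
  fun k => ⟨fock k, rfl⟩

/-! ## Expansions over the quadratures -/

/-- The function `x ↦ ∫ C(t) (2π)^{-1/2} exp(-½ (t - 2ix)²) dt`. -/
noncomputable def kernelTransform (C : ℝ → ℂ) (x : ℝ) : ℂ := ∫ t : ℝ, C t * gaussKernel t x

/-- The expansion `X = ∫_0^π dφ/π ∫ dt C(φ,t) F(t,φ)`.

For each `φ` the operator `∫ dt C(φ,t) F(t,φ)` is given by Bochner integrals on the vectors with
bounded spectral support with respect to `X_φ`, a core of every function of `X_φ` that is bounded
on bounded sets; there it is the function `f_φ = ∫ C(φ,t) (2π)^{-1/2} exp(-½ (t - 2i ·)²) dt` of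
`X_φ`. The identity `X = ∫_0^π f_φ(X_φ) dφ/π` is the one of the matrix elements in the number
basis. All the integrals converge absolutely. -/
def IsQuadratureExpansion (C : ℝ → ℝ → ℂ) (X : Hilb →ₗ.[ℂ] Hilb) (hX : DefinedOnFock X) : Prop :=
  (∀ φ x : ℝ, Integrable (fun t : ℝ => C φ t * gaussKernel t x) volume) ∧
  (∀ (φ R : ℝ) (v : Hilb), SpectrallyBounded φ R v →
    ∃ (hF : ∀ t : ℝ, v ∈ (opF t φ).domain)
      (hf : v ∈ (funcCalc φ (kernelTransform (C φ))).domain),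
      Integrable (fun t : ℝ => C φ t • (opF t φ) ⟨v, hF t⟩) volume ∧
      ∫ t : ℝ, C φ t • (opF t φ) ⟨v, hF t⟩ = (funcCalc φ (kernelTransform (C φ))) ⟨v, hf⟩) ∧
  (∀ k l : ℕ,
    (∀ φ : ℝ, SpectralFormConverges φ (kernelTransform (C φ)) (fockKet k) (fockKet l)) ∧
    IntervalIntegrable
      (fun φ : ℝ => spectralForm φ (kernelTransform (C φ)) (fockKet k) (fockKet l))
      volume 0 Real.pi ∧
    inner ℂ (fockKet k) (X ⟨fockKet l, hX l⟩) =
      (1 / Real.pi : ℂ) * ∫ φ in (0 : ℝ)..Real.pi,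
        spectralForm φ (kernelTransform (C φ)) (fockKet k) (fockKet l))

/-- The pairing `Tr[X W'_{φ,x}]` of `X` with
`W'_{φ,x} = ∫ dt (2π)^{-1/2} exp(-½ (t - 2ix)²) G†(t,φ)`, the integral being taken in the sense of
the pairing with `X`. -/
noncomputable def dualPairing (φ x : ℝ) (X : Hilb →ₗ.[ℂ] Hilb) (hX : DefinedOnFock X) : ℂ :=
  ∫ t : ℝ, gaussKernel t x * traceAdj (opG t φ) X hX

end Quadrature

namespace Quadrature

/-! The identity rests on three computations that fit together.

Trace. The normalizations of the two coherent states combine with `e^{t²/2}` into `e^w`, `w =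
t²θ(1-θ)`, so the number-basis elements of `G` are derivatives of explicit integrals over `θ`. In
`Tr[G† a†ᵐ a^q]` only the pairs `(m+s, q+s)` contribute, and the phases `(-i)^{2s}` make the sum
over `s` an alternating exponential series (`hasSum_alternating_radialElement`). It sums to
`e^{-w}`, which cancels `e^w` and leaves a Beta integral. The trace is therefore `e^{iφ(q-m)}
(-it)^{m+q} / (m+q choose m)`.

Gaussian moments. Integrating `(-it)ⁿ` against the kernel gives the Hermite polynomial `He_n(2x)`
(`integral_pow_mul_gaussKernel`). Normal-ordered powers obey the Hermite recursion, so `He_n(2X_φ) =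
:(2X_φ)ⁿ:` (`spectralRep_wick`), a binomial sum of monomials `a†^r a^{n-r}` with phases
`e^{iφ(2r-n)}`.

Average over `φ`. Multiplied by `e^{iφ(q-m)}`, these phases become `e^{2iφ(r-m)}`. Their mean over
`[0, π]` selects `r = m`, and the binomial coefficient cancels (`integral_traceCoeff_mul`).

For infinite series every exchange of sum and integral is absolute, and each costs the same weight
`√(m+q)!`: it bounds `|t|^{m+q}` pointwise, the absolute Gaussian moments, and the absolute spectral
integrals of `He_{m+q}` between number states. The last bound is the delicate one
(`norm_hermiteIntegrand`): `He_n(2x)` times the vacuum is `√n!` times the `n`-th number state up to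
a phase, so Cauchy-Schwarz applies to a normalized vector. -/

/-! ### Commutation relation, number states and matrix elements of monomials -/

theorem derivCLM_position (f : 𝓢(ℝ, ℂ)) :
    SchwartzMap.derivCLM ℂ ℂ (position f) = f + position (SchwartzMap.derivCLM ℂ ℂ f) := by
  ext x
  have e : (position f : ℝ → ℂ) = fun x : ℝ => (x : ℂ) * f x := funext (position_apply f)
  have h : HasDerivAt (fun x : ℝ => (x : ℂ) * f x) (1 * f x + (x : ℂ) * deriv f x) x :=
    (Complex.ofRealCLM.hasDerivAt (x := x)).mul (f.hasDerivAt x)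
  rw [SchwartzMap.derivCLM_apply, e, h.deriv, add_apply, position_apply,
    SchwartzMap.derivCLM_apply, one_mul]

theorem annihilation_mul_creation :
    annihilation * creation = creation * annihilation + 1 := by
  have h : SchwartzMap.derivCLM ℂ ℂ * position = 1 + position * SchwartzMap.derivCLM ℂ ℂ :=
    ContinuousLinearMap.ext derivCLM_position
  simp only [annihilation, creation, mul_add, add_mul, mul_sub, sub_mul, smul_mul_assoc,
    mul_smul_comm, h, smul_add]
  module

theorem annihilation_mul_creation_pow (n : ℕ) :
    annihilation * creation ^ n = creation ^ n * annihilation + (n : ℂ) • creation ^ (n - 1) := by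
  induction n with
  | zero => simp
  | succ n ih =>
    -- At `n = 0` the truncated exponent is wrong, but the coefficient vanishes.
    have h : (n : ℂ) • (creation ^ (n - 1) * creation) = (n : ℂ) • creation ^ n := by
      rcases n with _ | n
      · simp
      · rw [Nat.add_sub_cancel, ← pow_succ]
    calc annihilation * creation ^ (n + 1) = annihilation * creation ^ n * creation := by
          rw [pow_succ, mul_assoc]
      _ = creation ^ n * (annihilation * creation)
          + (n : ℂ) • (creation ^ (n - 1) * creation) := by
          rw [ih, add_mul, mul_assoc, smul_mul_assoc]
      _ = creation ^ n * creation * annihilation + creation ^ n + (n : ℂ) • creation ^ n := by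
          rw [h, annihilation_mul_creation, mul_add, mul_one, mul_assoc]
      _ = _ := by
          rw [Nat.add_sub_cancel, ← pow_succ]
          push_cast
          module

theorem annihilation_vacuum : annihilation vacuum = 0 := by
  ext x
  have e : (vacuum : ℝ → ℂ) = fun x : ℝ => (((2 / Real.pi) ^ (1 / 4 : ℝ) : ℝ) : ℂ) *
      ((Real.exp (-x ^ 2) : ℝ) : ℂ) := rfl
  have h1 : HasDerivAt (fun x : ℝ => Real.exp (-x ^ 2)) (Real.exp (-x ^ 2) * (-(2 * x))) x := by
    have := ((hasDerivAt_pow 2 x).neg).exp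
    simpa using! this
  have h : deriv (vacuum : ℝ → ℂ) x = (((2 / Real.pi) ^ (1 / 4 : ℝ) : ℝ) : ℂ) *
      ((Real.exp (-x ^ 2) * (-(2 * x)) : ℝ) : ℂ) := by
    rw [e]
    exact (h1.ofReal_comp.const_mul _).deriv
  simp only [annihilation, add_apply, smul_apply, position_apply, SchwartzMap.derivCLM_apply, h,
    smul_eq_mul, zero_apply]
  rw [e]
  push_cast
  ring

theorem norm_vacuum : ‖ket vacuum‖ = 1 := by
  have hpi : 0 < Real.pi := Real.pi_pos
  have hp : (0 : ℝ) < 2 / Real.pi := by positivity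
  have e : ∀ x : ℝ, vacuum x = (((2 / Real.pi) ^ (1 / 4 : ℝ) : ℝ) : ℂ) *
      ((Real.exp (-x ^ 2) : ℝ) : ℂ) := fun _ => rfl
  have h : inner ℂ (ket vacuum) (ket vacuum) = 1 := by
    unfold ket
    rw [SchwartzMap.inner_toL2_toL2_eq _ _ volume]
    have h2 : ∀ x : ℝ, inner ℂ (vacuum x) (vacuum x) =
        (((2 / Real.pi) ^ (1 / 2 : ℝ) * Real.exp (-2 * x ^ 2) : ℝ) : ℂ) := by
      intro x
      have h3 : (2 / Real.pi) ^ (1 / 2 : ℝ) =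
          (2 / Real.pi) ^ (1 / 4 : ℝ) * (2 / Real.pi) ^ (1 / 4 : ℝ) := by
        rw [← Real.rpow_add hp]
        norm_num
      have h4 : Real.exp (-2 * x ^ 2) = Real.exp (-x ^ 2) * Real.exp (-x ^ 2) := by
        rw [← Real.exp_add]
        ring_nf
      rw [e, h3, h4, RCLike.inner_apply]
      simp only [map_mul, Complex.conj_ofReal]
      push_cast
      ring
    simp_rw [h2]
    rw [integral_complex_ofReal, integral_const_mul, integral_gaussian, ← Real.sqrt_eq_rpow,
      ← Real.sqrt_mul hp.le]
    have : 2 / Real.pi * (Real.pi / 2) = 1 := by field_simp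
    rw [this]
    simp
  have h5 : ‖ket vacuum‖ ^ 2 = 1 := by
    have h6 : (1 : ℂ) = ((‖ket vacuum‖ : ℝ) : ℂ) ^ 2 :=
      h.symm.trans (inner_self_eq_norm_sq_to_K (𝕜 := ℂ) (ket vacuum))
    exact_mod_cast h6.symm
  nlinarith [norm_nonneg (ket vacuum)]

theorem ket_add (f g : 𝓢(ℝ, ℂ)) : ket (f + g) = ket f + ket g :=
  map_add (SchwartzMap.toLpCLM ℂ ℂ 2 (volume : Measure ℝ)) f g

theorem ket_smul (c : ℂ) (f : 𝓢(ℝ, ℂ)) : ket (c • f) = c • ket f :=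
  map_smul (SchwartzMap.toLpCLM ℂ ℂ 2 (volume : Measure ℝ)) c f

theorem ket_zero : ket 0 = 0 :=
  map_zero (SchwartzMap.toLpCLM ℂ ℂ 2 (volume : Measure ℝ))

theorem ket_sum {ι : Type*} (s : Finset ι) (f : ι → 𝓢(ℝ, ℂ)) :
    ket (∑ i ∈ s, f i) = ∑ i ∈ s, ket (f i) :=
  map_sum (SchwartzMap.toLpCLM ℂ ℂ 2 (volume : Measure ℝ)) f s

/-- Integration by parts: multiplication by `x` is symmetric and `d/dx` antisymmetric, so the sign
between them flips. -/
theorem inner_ket_creation (f g : 𝓢(ℝ, ℂ)) :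
    inner ℂ (ket f) (ket (creation g)) = inner ℂ (ket (annihilation f)) (ket g) := by
  let B : ℂ →L[ℝ] ℂ →L[ℝ] ℂ :=
    (ContinuousLinearMap.mul ℝ ℂ).comp Complex.conjCLE.toContinuousLinearMap
  have hi : ∀ f g : 𝓢(ℝ, ℂ), Integrable (fun x => (starRingEnd ℂ) (f x) * g x) volume :=
    fun f g => (SchwartzMap.pairing B f g).integrable
  have i1 := hi f (position g)
  have i2 := hi f (SchwartzMap.derivCLM ℂ ℂ g)
  have i3 := hi (position f) g
  have i4 := hi (SchwartzMap.derivCLM ℂ ℂ f) g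
  simp only [position_apply, SchwartzMap.derivCLM_apply] at i1 i2 i3 i4
  have hp : ∫ x, (starRingEnd ℂ) (f x) * deriv g x = -∫ x, (starRingEnd ℂ) (deriv f x) * g x :=
    SchwartzMap.integral_bilinear_deriv_right_eq_neg_left f g B
  unfold ket
  rw [SchwartzMap.inner_toL2_toL2_eq _ _ volume, SchwartzMap.inner_toL2_toL2_eq _ _ volume]
  have e1 : ∀ x, inner ℂ (f x) (creation g x) = (starRingEnd ℂ) (f x) * ((x : ℂ) * g x)
      - (1 / 2) * ((starRingEnd ℂ) (f x) * deriv g x) := by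
    intro x
    simp only [creation, sub_apply, smul_apply, position_apply, SchwartzMap.derivCLM_apply,
      smul_eq_mul, RCLike.inner_apply]
    ring
  have e2 : ∀ x, inner ℂ (annihilation f x) (g x) = (starRingEnd ℂ) ((x : ℂ) * f x) * g x
      + (1 / 2) * ((starRingEnd ℂ) (deriv f x) * g x) := by
    intro x
    simp only [annihilation, add_apply, smul_apply, position_apply, SchwartzMap.derivCLM_apply,
      smul_eq_mul, RCLike.inner_apply, map_add, map_mul, map_div₀, map_one, map_ofNat]
    ring
  simp_rw [e1, e2]
  rw [integral_sub i1 (i2.const_mul _), integral_add i3 (i4.const_mul _),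
    integral_const_mul, integral_const_mul, hp]
  have e3 : ∀ x : ℝ, (starRingEnd ℂ) (f x) * ((x : ℂ) * g x)
      = (starRingEnd ℂ) ((x : ℂ) * f x) * g x := by
    intro x
    simp only [map_mul, Complex.conj_ofReal]
    ring
  simp_rw [e3]
  ring

theorem sqrt_factorial_ne_zero (n : ℕ) : ((Real.sqrt n.factorial : ℝ) : ℂ) ≠ 0 := by
  have : 0 < Real.sqrt n.factorial := Real.sqrt_pos.2 (by positivity)
  exact_mod_cast this.ne'

theorem sqrt_factorial_mul_self (n : ℕ) :
    ((Real.sqrt n.factorial : ℝ) : ℂ) * ((Real.sqrt n.factorial : ℝ) : ℂ) = n.factorial := by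
  rw [← Complex.ofReal_mul, Real.mul_self_sqrt (by positivity)]
  simp

theorem creation_pow_vacuum (n : ℕ) :
    (creation ^ n) vacuum = ((Real.sqrt n.factorial : ℝ) : ℂ) • fock n := by
  rw [fock, smul_smul, mul_inv_cancel₀ (sqrt_factorial_ne_zero n), one_smul]

theorem annihilation_creation_pow_vacuum (n : ℕ) :
    annihilation ((creation ^ n) vacuum) = (n : ℂ) • (creation ^ (n - 1)) vacuum := by
  have h := congrArg (fun T : 𝓢(ℝ, ℂ) →L[ℂ] 𝓢(ℝ, ℂ) => T vacuum)
    (annihilation_mul_creation_pow n)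
  simpa [annihilation_vacuum] using h

theorem annihilation_pow_creation_pow_vacuum (q s : ℕ) :
    (annihilation ^ q) ((creation ^ (q + s)) vacuum) =
      (((q + s).factorial : ℂ) / s.factorial) • (creation ^ s) vacuum := by
  induction q with
  | zero =>
    have : (s.factorial : ℂ) ≠ 0 := by exact_mod_cast s.factorial_ne_zero
    simp [this]
  | succ q ih =>
    have e : q + 1 + s = (q + s) + 1 := by ring
    rw [pow_succ, mul_apply_eq_comp, e, annihilation_creation_pow_vacuum,
      Nat.add_sub_cancel, map_smul, ih, smul_smul, Nat.factorial_succ]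
    congr 1
    push_cast
    ring

theorem annihilation_pow_fock_of_lt {q n : ℕ} (h : n < q) : (annihilation ^ q) (fock n) = 0 := by
  obtain ⟨r, rfl⟩ := Nat.exists_eq_add_of_lt h
  have e : n + r + 1 = r + 1 + n := by ring
  -- The first `n` annihilations reduce `|n⟩` to a multiple of the vacuum; at least one more remains
  -- and kills it.
  have h0 := annihilation_pow_creation_pow_vacuum n 0
  rw [add_zero] at h0
  rw [fock, map_smul, e, pow_add, mul_apply_eq_comp, h0, map_smul, pow_succ,
    mul_apply_eq_comp]
  simp [annihilation_vacuum]

/-- Writing the level as `q + s` avoids truncated subtraction; `s` is also the index of the trace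
series below. -/
theorem normal_monomial_fock (m q s : ℕ) :
    (creation ^ m) ((annihilation ^ q) (fock (q + s))) =
      (((Real.sqrt (q + s).factorial * Real.sqrt (m + s).factorial / s.factorial : ℝ)) : ℂ) •
        fock (m + s) := by
  rw [fock, map_smul, annihilation_pow_creation_pow_vacuum, map_smul, map_smul,
    ← mul_apply_eq_comp, ← pow_add, creation_pow_vacuum, smul_smul, smul_smul]
  congr 1
  have h1 := sqrt_factorial_ne_zero (q + s)
  have h2 := sqrt_factorial_mul_self (q + s)
  have h3 : (s.factorial : ℂ) ≠ 0 := by exact_mod_cast s.factorial_ne_zero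
  push_cast
  rw [← h2]
  field_simp

theorem creation_fock (n : ℕ) :
    creation (fock n) = ((Real.sqrt (n + 1 : ℕ) : ℝ) : ℂ) • fock (n + 1) := by
  have h := normal_monomial_fock 1 0 n
  simp only [pow_one, pow_zero, zero_add, one_apply_eq_self] at h
  rw [h, add_comm 1 n]
  congr 2
  rw [Nat.factorial_succ, Nat.cast_mul, Real.sqrt_mul (by positivity)]
  have : (n.factorial : ℝ) ≠ 0 := by exact_mod_cast n.factorial_ne_zero
  rw [div_eq_iff this]
  linear_combination Real.sqrt (n + 1 : ℕ) *
    Real.mul_self_sqrt (show (0 : ℝ) ≤ n.factorial by positivity)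

theorem annihilation_fock_succ (n : ℕ) :
    annihilation (fock (n + 1)) = ((Real.sqrt (n + 1 : ℕ) : ℝ) : ℂ) • fock n := by
  have h := normal_monomial_fock 0 1 n
  simp only [pow_one, pow_zero, zero_add, one_apply_eq_self] at h
  rw [add_comm n 1, h]
  congr 2
  rw [add_comm 1 n, Nat.factorial_succ, Nat.cast_mul, Real.sqrt_mul (by positivity)]
  have : (n.factorial : ℝ) ≠ 0 := by exact_mod_cast n.factorial_ne_zero
  rw [div_eq_iff this]
  linear_combination Real.sqrt (n + 1 : ℕ) *
    Real.mul_self_sqrt (show (0 : ℝ) ≤ n.factorial by positivity)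

theorem fock_zero : fock 0 = vacuum := by
  simp [fock]

theorem inner_fockKet_succ (m n : ℕ) :
    ((Real.sqrt (n + 1 : ℕ) : ℝ) : ℂ) * inner ℂ (fockKet m) (fockKet (n + 1)) =
      inner ℂ (ket (annihilation (fock m))) (fockKet n) := by
  rw [fockKet, fockKet, fockKet, ← inner_ket_creation, creation_fock, ket_smul, inner_smul_right]

/-- Adjointness strips one excitation from both sides, reducing to the vacuum, which is normalized
and annihilated by `a`. -/
theorem inner_fockKet (m n : ℕ) :
    inner ℂ (fockKet m) (fockKet n) = if m = n then (1 : ℂ) else 0 := by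
  have hs : ∀ n : ℕ, ((Real.sqrt (n + 1 : ℕ) : ℝ) : ℂ) ≠ 0 := by
    intro n
    have : 0 < Real.sqrt (n + 1 : ℕ) := Real.sqrt_pos.2 (by positivity)
    exact_mod_cast this.ne'
  have hz : ∀ n, inner ℂ (fockKet 0) (fockKet (n + 1)) = (0 : ℂ) := by
    intro n
    have h := inner_fockKet_succ 0 n
    rw [fock_zero, annihilation_vacuum, ket_zero, inner_zero_left] at h
    exact (mul_eq_zero.1 h).resolve_left (hs n)
  induction m generalizing n with
  | zero =>
    rcases n with _ | n
    · rw [if_pos rfl, inner_self_eq_norm_sq_to_K, fockKet, fock_zero, norm_vacuum]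
      simp
    · rw [hz, if_neg (by omega)]
  | succ m ih =>
    rcases n with _ | n
    · rw [← inner_conj_symm, hz, if_neg (by omega), map_zero]
    · have h := inner_fockKet_succ (m + 1) n
      rw [annihilation_fock_succ, ket_smul, inner_smul_left, Complex.conj_ofReal] at h
      change _ = _ * inner ℂ (fockKet m) (fockKet n) at h
      rw [ih] at h
      by_cases hmn : m = n
      · subst hmn
        rw [if_pos rfl] at h ⊢
        exact mul_left_cancel₀ (hs m) h
      · rw [if_neg hmn, mul_zero] at h
        rw [if_neg (by omega)]
        exact (mul_eq_zero.1 h).resolve_left (hs n)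

theorem orthonormal_fockKet : Orthonormal ℂ fockKet :=
  orthonormal_iff_ite.2 inner_fockKet

theorem norm_fockKet (n : ℕ) : ‖fockKet n‖ = 1 := orthonormal_fockKet.1 n

/-- The matrix element `⟨k| a†ᵐ a^q |n⟩`. -/
noncomputable def monomialElement (m q k n : ℕ) : ℂ :=
  inner ℂ (fockKet k) (ket ((creation ^ m) ((annihilation ^ q) (fock n))))

theorem monomialElement_add (m q k s : ℕ) :
    monomialElement m q k (q + s) = if k = m + s then
      (((Real.sqrt (q + s).factorial * Real.sqrt (m + s).factorial / s.factorial : ℝ)) : ℂ)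
      else 0 := by
  rw [monomialElement, normal_monomial_fock, ket_smul, inner_smul_right]
  change _ * inner ℂ (fockKet k) (fockKet (m + s)) = _
  rw [inner_fockKet]
  simp

theorem monomialElement_eq_zero {m q k n : ℕ} (h : ∀ s, ¬ (n = q + s ∧ k = m + s)) :
    monomialElement m q k n = 0 := by
  rcases lt_or_ge n q with hn | hn
  · rw [monomialElement, annihilation_pow_fock_of_lt hn, map_zero, ket_zero, inner_zero_right]
  · obtain ⟨s, rfl⟩ := Nat.exists_eq_add_of_le hn
    rw [monomialElement_add, if_neg]
    exact fun hk => h s ⟨rfl, hk⟩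

/-! ### Hermite polynomials as moments of the complex Gaussian kernel -/

/-- The Hermite polynomials `He_n` orthogonal with respect to `e^{-y²/2}`, as functions. -/
noncomputable def hermiteFn : ℕ → ℝ → ℝ
  | 0, _ => 1
  | 1, y => y
  | n + 2, y => y * hermiteFn (n + 1) y - (n + 1) * hermiteFn n y

theorem continuous_hermiteFn : ∀ n, Continuous (hermiteFn n)
  | 0 => by simpa only [hermiteFn] using continuous_const
  | 1 => by
    simp only [hermiteFn]
    exact continuous_id
  | n + 2 => by
    simp only [hermiteFn]
    exact (continuous_id.mul (continuous_hermiteFn (n + 1))).sub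
      (continuous_const.mul (continuous_hermiteFn n))

theorem norm_gaussKernel (t x : ℝ) : ‖gaussKernel t x‖ =
    (Real.sqrt (2 * Real.pi))⁻¹ * Real.exp (2 * x ^ 2) * Real.exp (-(1 / 2) * t ^ 2) := by
  have h0 : (0 : ℝ) ≤ (Real.sqrt (2 * Real.pi))⁻¹ := by positivity
  rw [gaussKernel, norm_mul, Complex.norm_real, Real.norm_of_nonneg h0, Complex.norm_exp,
    mul_assoc (Real.sqrt (2 * Real.pi))⁻¹, ← Real.exp_add]
  congr 2
  have : -(1 / 2) * ((t : ℂ) - 2 * Complex.I * x) ^ 2 =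
      ((2 * x ^ 2 + -(1 / 2) * t ^ 2 : ℝ) : ℂ) + ((2 * t * x : ℝ) : ℂ) * Complex.I := by
    push_cast
    linear_combination (-2 * (x : ℂ) ^ 2) * Complex.I_sq
  rw [this, Complex.add_re, Complex.ofReal_re, Complex.re_ofReal_mul, Complex.I_re, mul_zero,
    add_zero]

theorem gaussKernel_zero_right_mul (t x : ℝ) : gaussKernel t x =
    gaussKernel t 0 * (Complex.exp (2 * (x : ℂ) ^ 2) *
      Complex.exp (((2 * t * x : ℝ) : ℂ) * Complex.I)) := by
  rw [gaussKernel, gaussKernel, mul_assoc (((Real.sqrt (2 * Real.pi))⁻¹ : ℝ) : ℂ),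
    ← Complex.exp_add, ← Complex.exp_add]
  congr 2
  push_cast
  linear_combination (-2 * (x : ℂ) ^ 2) * Complex.I_sq

theorem integrable_abs_pow_mul_exp (n : ℕ) :
    Integrable (fun t : ℝ => |t| ^ n * Real.exp (-(1 / 2) * t ^ 2)) := by
  have h := (integrable_rpow_mul_exp_neg_mul_sq (b := 1 / 2) (by norm_num)
    (s := n) (by have : (0 : ℝ) ≤ n := n.cast_nonneg; linarith)).norm
  refine h.congr (Filter.Eventually.of_forall fun t => ?_)
  simp only [norm_mul, Real.norm_eq_abs, Real.abs_exp, Real.rpow_natCast, abs_pow]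

theorem integral_abs_pow_mul_exp (n : ℕ) :
    ∫ t : ℝ, |t| ^ n * Real.exp (-(1 / 2) * t ^ 2) =
      (1 / 2 : ℝ) ^ (-((n : ℝ) + 1) / 2) * Real.Gamma (((n : ℝ) + 1) / 2) := by
  have h := integral_comp_abs (f := fun t : ℝ => t ^ n * Real.exp (-(1 / 2) * t ^ 2))
  simp only [sq_abs] at h
  rw [h]
  have h2 := integral_rpow_mul_exp_neg_mul_rpow (p := 2) (q := n) (b := 1 / 2) (by norm_num)
    (by have : (0 : ℝ) ≤ n := n.cast_nonneg; linarith) (by norm_num)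
  simp only [Real.rpow_natCast, Real.rpow_two] at h2
  rw [h2]
  ring

/-- The moments satisfy `M_{n+2} = (n+1) M_n`, while `(n+1)√n! ≤ √(n+2)!`. The constant `3` covers
both initial values `M_0 = √(2π)` and `M_1 = 2`. -/
theorem integral_abs_pow_mul_exp_le (n : ℕ) :
    ∫ t : ℝ, |t| ^ n * Real.exp (-(1 / 2) * t ^ 2) ≤ 3 * Real.sqrt n.factorial := by
  induction n using Nat.twoStepInduction with
  | zero =>
    rw [integral_abs_pow_mul_exp]
    have h1 : (1 / 2 : ℝ) ^ (-(((0 : ℕ) : ℝ) + 1) / 2) = Real.sqrt 2 := by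
      rw [one_div, Real.inv_rpow (by norm_num), ← Real.rpow_neg (by norm_num), Real.sqrt_eq_rpow]
      norm_num
    have h2 : Real.Gamma ((((0 : ℕ) : ℝ) + 1) / 2) = Real.sqrt Real.pi := by
      rw [← Real.Gamma_one_half_eq]
      norm_num
    rw [h1, h2, ← Real.sqrt_mul (by norm_num)]
    simp only [Nat.factorial_zero, Nat.cast_one, Real.sqrt_one, mul_one]
    rw [Real.sqrt_le_left (by norm_num)]
    nlinarith [Real.pi_lt_d2]
  | one =>
    rw [integral_abs_pow_mul_exp]
    have h1 : (1 / 2 : ℝ) ^ (-(((1 : ℕ) : ℝ) + 1) / 2) = 2 := by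
      rw [one_div, Real.inv_rpow (by norm_num), ← Real.rpow_neg (by norm_num)]
      norm_num
    have h2 : Real.Gamma ((((1 : ℕ) : ℝ) + 1) / 2) = 1 := by
      norm_num
    rw [h1, h2]
    norm_num
  | more n ih _ =>
    have hn : (0 : ℝ) < n + 1 := by positivity
    have e : ∫ t : ℝ, |t| ^ (n + 2) * Real.exp (-(1 / 2) * t ^ 2) =
        (n + 1) * ∫ t : ℝ, |t| ^ n * Real.exp (-(1 / 2) * t ^ 2) := by
      rw [integral_abs_pow_mul_exp, integral_abs_pow_mul_exp]
      have e1 : (((n + 2 : ℕ) : ℝ) + 1) / 2 = ((n : ℝ) + 1) / 2 + 1 := by push_cast; ring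
      have e2 : -(((n + 2 : ℕ) : ℝ) + 1) / 2 = -((n : ℝ) + 1) / 2 - 1 := by push_cast; ring
      rw [e1, e2, Real.Gamma_add_one (by positivity), Real.rpow_sub_one (by norm_num)]
      ring
    have h : (n + 1 : ℝ) * Real.sqrt n.factorial ≤ Real.sqrt (n + 2).factorial := by
      apply Real.le_sqrt_of_sq_le
      rw [mul_pow, Real.sq_sqrt (by positivity), Nat.factorial_succ, Nat.factorial_succ]
      push_cast
      have : (0 : ℝ) < n.factorial := by positivity
      nlinarith [mul_pos hn this]
    rw [e]
    refine (mul_le_mul_of_nonneg_left ih hn.le).trans ?_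
    refine le_trans (le_of_eq ?_) (mul_le_mul_of_nonneg_left h (by norm_num : (0 : ℝ) ≤ 3))
    ring

theorem integrable_pow_mul_gaussKernel (n : ℕ) (x : ℝ) :
    Integrable (fun t : ℝ => (t : ℂ) ^ n * gaussKernel t x) := by
  refine ((integrable_abs_pow_mul_exp n).const_mul
    ((Real.sqrt (2 * Real.pi))⁻¹ * Real.exp (2 * x ^ 2))).mono' ?_ ?_
  · refine Continuous.aestronglyMeasurable ?_
    unfold gaussKernel
    fun_prop
  · refine Filter.Eventually.of_forall fun t => le_of_eq ?_
    rw [norm_mul, norm_gaussKernel, norm_pow, Complex.norm_real, Real.norm_eq_abs]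
    ring

theorem integral_norm_pow_mul_gaussKernel_le (n : ℕ) (x : ℝ) :
    ∫ t : ℝ, ‖(t : ℂ) ^ n * gaussKernel t x‖ ≤
      3 * Real.exp (2 * x ^ 2) * Real.sqrt n.factorial := by
  have e : ∀ t : ℝ, ‖(t : ℂ) ^ n * gaussKernel t x‖ =
      ((Real.sqrt (2 * Real.pi))⁻¹ * Real.exp (2 * x ^ 2)) *
        (|t| ^ n * Real.exp (-(1 / 2) * t ^ 2)) := by
    intro t
    rw [norm_mul, norm_gaussKernel, norm_pow, Complex.norm_real, Real.norm_eq_abs]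
    ring
  have h1 : (Real.sqrt (2 * Real.pi))⁻¹ ≤ 1 := by
    apply inv_le_one_of_one_le₀
    rw [Real.one_le_sqrt]
    nlinarith [Real.pi_gt_three]
  simp_rw [e]
  rw [integral_const_mul]
  calc (Real.sqrt (2 * Real.pi))⁻¹ * Real.exp (2 * x ^ 2) *
        ∫ t : ℝ, |t| ^ n * Real.exp (-(1 / 2) * t ^ 2)
      ≤ 1 * Real.exp (2 * x ^ 2) * (3 * Real.sqrt n.factorial) := by
        gcongr
        exact integral_abs_pow_mul_exp_le n
    _ = _ := by ring

theorem hasDerivAt_gaussKernel (t x : ℝ) :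
    HasDerivAt (fun t : ℝ => gaussKernel t x)
      (-((t : ℂ) - 2 * Complex.I * x) * gaussKernel t x) t := by
  have h1 : HasDerivAt (fun t : ℝ => (t : ℂ) - 2 * Complex.I * x) 1 t :=
    (Complex.ofRealCLM.hasDerivAt (x := t)).sub_const _
  have h2 : HasDerivAt (fun t : ℝ => gaussKernel t x) _ t :=
    (((h1.fun_pow 2).const_mul (-(1 / 2) : ℂ)).cexp).const_mul
      ((((Real.sqrt (2 * Real.pi))⁻¹ : ℝ) : ℂ))
  refine h2.congr_deriv ?_
  simp only [gaussKernel]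
  push_cast
  ring

theorem integral_gaussKernel (x : ℝ) : ∫ t : ℝ, gaussKernel t x = 1 := by
  have h := integral_cexp_quadratic (b := -(1 / 2)) (by norm_num) (2 * Complex.I * x)
    (2 * (x : ℂ) ^ 2)
  have e : ∀ t : ℝ, gaussKernel t x = (((Real.sqrt (2 * Real.pi))⁻¹ : ℝ) : ℂ) *
      Complex.exp (-(1 / 2) * (t : ℂ) ^ 2 + 2 * Complex.I * x * t + 2 * (x : ℂ) ^ 2) := by
    intro t
    rw [gaussKernel]
    congr 2
    linear_combination (-2 * (x : ℂ) ^ 2) * Complex.I_sq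
  simp_rw [e]
  rw [integral_const_mul, h]
  -- Completing the square produces `-2x²`, which the prefactor `e^{2x²}` cancels; hence the
  -- integral does not depend on `x`.
  have e2 : (2 * (x : ℂ) ^ 2 - (2 * Complex.I * x) ^ 2 / (4 * -(1 / 2))) = 0 := by
    linear_combination (2 * (x : ℂ) ^ 2) * Complex.I_sq
  have e3 : ((Real.pi : ℂ) / -(-(1 / 2))) ^ (1 / 2 : ℂ) =
      ((Real.sqrt (2 * Real.pi) : ℝ) : ℂ) := by
    rw [Real.sqrt_eq_rpow, Complex.ofReal_cpow (by positivity)]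
    congr 1
    · push_cast; ring
    · push_cast; ring
  rw [e2, e3, Complex.exp_zero, mul_one, ← Complex.ofReal_mul, inv_mul_cancel₀]
  · simp
  · have : 0 < Real.sqrt (2 * Real.pi) := Real.sqrt_pos.2 (by positivity)
    exact this.ne'

/-- The derivative of `tⁿ` times the kernel integrates to zero. For `n = 0` the truncated power
carries the factor `0`. -/
theorem integral_pow_succ_mul_gaussKernel (n : ℕ) (x : ℝ) :
    ∫ t : ℝ, (t : ℂ) ^ (n + 1) * gaussKernel t x =
      2 * Complex.I * x * (∫ t : ℝ, (t : ℂ) ^ n * gaussKernel t x) +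
        n * ∫ t : ℝ, (t : ℂ) ^ (n - 1) * gaussKernel t x := by
  have i1 := integrable_pow_mul_gaussKernel (n - 1) x
  have i2 := integrable_pow_mul_gaussKernel n x
  have i3 := integrable_pow_mul_gaussKernel (n + 1) x
  have i5 : Integrable (fun t : ℝ => (n : ℂ) * ((t : ℂ) ^ (n - 1) * gaussKernel t x) -
      (t : ℂ) ^ (n + 1) * gaussKernel t x) := (i1.const_mul (n : ℂ)).sub i3
  have i4 := i5.add (i2.const_mul (2 * Complex.I * x))
  have h : ∀ t : ℝ, HasDerivAt (fun t : ℝ => (t : ℂ) ^ n * gaussKernel t x)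
      ((n : ℂ) * ((t : ℂ) ^ (n - 1) * gaussKernel t x) - (t : ℂ) ^ (n + 1) * gaussKernel t x +
        2 * Complex.I * x * ((t : ℂ) ^ n * gaussKernel t x)) t := by
    intro t
    have h1 : HasDerivAt (fun t : ℝ => (t : ℂ) ^ n) ((n : ℂ) * (t : ℂ) ^ (n - 1) * 1) t :=
      (Complex.ofRealCLM.hasDerivAt (x := t)).pow n
    refine (h1.mul (hasDerivAt_gaussKernel t x)).congr_deriv ?_
    ring
  have h0 := integral_eq_zero_of_hasDerivAt_of_integrable h i4 i2
  rw [integral_add i5 (i2.const_mul _), integral_sub (i1.const_mul _) i3,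
    integral_const_mul, integral_const_mul] at h0
  linear_combination -h0

/-- With the factors `(-i)ⁿ`, the recursion of the moments turns into the Hermite recursion at `y =
2x`, with the same two initial values. -/
theorem integral_pow_mul_gaussKernel (n : ℕ) (x : ℝ) :
    ∫ t : ℝ, (-Complex.I * t) ^ n * gaussKernel t x = hermiteFn n (2 * x) := by
  have e : ∀ n : ℕ, ∫ t : ℝ, (-Complex.I * t) ^ n * gaussKernel t x =
      (-Complex.I) ^ n * ∫ t : ℝ, (t : ℂ) ^ n * gaussKernel t x := by
    intro n
    rw [← integral_const_mul]
    congr 1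
    funext t
    rw [mul_pow, mul_assoc]
  induction n using Nat.twoStepInduction with
  | zero => simp [hermiteFn, integral_gaussKernel]
  | one =>
    have h := integral_pow_succ_mul_gaussKernel 0 x
    simp only [pow_zero, one_mul, integral_gaussKernel, Nat.cast_zero, zero_mul, add_zero,
      zero_add] at h
    rw [e, h]
    simp only [hermiteFn]
    push_cast
    linear_combination (-2 * (x : ℂ)) * Complex.I_sq
  | more n ih1 ih2 =>
    rw [e] at ih1 ih2
    rw [e, integral_pow_succ_mul_gaussKernel (n + 1) x]
    simp only [hermiteFn, Nat.add_sub_cancel]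
    push_cast
    rw [← ih1, ← ih2, pow_succ, pow_succ]
    linear_combination ((-Complex.I) ^ n * ((n : ℂ) + 1) *
      (∫ t : ℝ, (t : ℂ) ^ n * gaussKernel t x) + 2 * (-Complex.I) ^ n * (-Complex.I) * (x : ℂ) *
      (∫ t : ℝ, (t : ℂ) ^ (n + 1) * gaussKernel t x) * (-1)) * Complex.I_sq

/-! ### Normal-ordered powers of a quadrature are Hermite polynomials in it -/

/-- The normally ordered power `:(2 X_φ)ⁿ:`. -/
noncomputable def wick (φ : ℝ) (n : ℕ) : 𝓢(ℝ, ℂ) →L[ℂ] 𝓢(ℝ, ℂ) :=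
  ∑ p ∈ Finset.HasAntidiagonal.antidiagonal n,
    ((n.choose p.1 : ℂ) * Complex.exp (Complex.I * φ * ((p.1 : ℂ) - p.2))) •
      (creation ^ p.1 * annihilation ^ p.2)

/-- Normal ordering means that creators multiply from the left and annihilators from the right. Left
and right multiplications commute, so the binomial theorem applies and the powers follow a one-step
recursion. -/
theorem wick_eq_pow (φ : ℝ) (n : ℕ) : wick φ n =
    ((LinearMap.mulLeft ℂ (Complex.exp (Complex.I * φ) • creation) +
      LinearMap.mulRight ℂ (Complex.exp (-(Complex.I * φ)) • annihilation)) ^ n) 1 := by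
  have hcomm : Commute (LinearMap.mulLeft ℂ (Complex.exp (Complex.I * φ) • creation))
      (LinearMap.mulRight ℂ (Complex.exp (-(Complex.I * φ)) • annihilation)) :=
    LinearMap.commute_mulLeft_right _ _
  rw [hcomm.add_pow', LinearMap.sum_apply, wick]
  refine Finset.sum_congr rfl fun p _ => ?_
  rw [LinearMap.smul_apply, Module.End.mul_apply, LinearMap.pow_mulLeft, LinearMap.pow_mulRight,
    LinearMap.mulRight_apply, LinearMap.mulLeft_apply, one_mul, smul_pow, smul_pow,
    smul_mul_smul_comm, ← Nat.cast_smul_eq_nsmul ℂ, smul_smul, ← Complex.exp_nat_mul,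
    ← Complex.exp_nat_mul, ← Complex.exp_add]
  congr 3
  ring

theorem wick_zero (φ : ℝ) : wick φ 0 = 1 := by
  rw [wick_eq_pow]
  simp

theorem wick_succ (φ : ℝ) (n : ℕ) : wick φ (n + 1) =
    Complex.exp (Complex.I * φ) • creation * wick φ n +
      wick φ n * Complex.exp (-(Complex.I * φ)) • annihilation := by
  rw [wick_eq_pow φ (n + 1), pow_succ', Module.End.mul_apply, ← wick_eq_pow]
  rfl

/-- Commuting with `a` differentiates in `a†`. This commutator yields the lower-order term of the
Hermite recursion. -/
theorem annihilation_mul_wick_succ (φ : ℝ) (n : ℕ) :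
    Complex.exp (-(Complex.I * φ)) • annihilation * wick φ (n + 1) =
      wick φ (n + 1) * Complex.exp (-(Complex.I * φ)) • annihilation +
        ((n : ℂ) + 1) • wick φ n := by
  -- The opposite phases cancel, so the rotated pair obeys the same commutation relation.
  have hc : Complex.exp (-(Complex.I * φ)) • annihilation * Complex.exp (Complex.I * φ) • creation
      = Complex.exp (Complex.I * φ) • creation * Complex.exp (-(Complex.I * φ)) • annihilation
        + 1 := by
    rw [smul_mul_smul_comm, smul_mul_smul_comm, annihilation_mul_creation, ← Complex.exp_add,
      ← Complex.exp_add, neg_add_cancel, add_neg_cancel, Complex.exp_zero, one_smul, one_smul]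
  generalize ha : Complex.exp (-(Complex.I * φ)) • annihilation = B at *
  generalize hb : Complex.exp (Complex.I * φ) • creation = A at *
  have hw : ∀ n, wick φ (n + 1) = A * wick φ n + wick φ n * B := by
    intro n
    rw [wick_succ, ha, hb]
  induction n with
  | zero =>
    rw [hw, wick_zero, mul_one, one_mul, mul_add, add_mul, hc]
    simp only [Nat.cast_zero, zero_add, one_smul]
    abel
  | succ n ih =>
    calc B * wick φ (n + 1 + 1)
        = (B * A) * wick φ (n + 1) + (B * wick φ (n + 1)) * B := by
          rw [hw (n + 1), mul_add, mul_assoc, mul_assoc]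
      _ = A * (B * wick φ (n + 1)) + wick φ (n + 1) + (B * wick φ (n + 1)) * B := by
          rw [hc, add_mul, one_mul, mul_assoc]
      _ = (A * wick φ (n + 1) + wick φ (n + 1) * B) * B +
          (((n : ℂ) + 1) • (A * wick φ n + wick φ n * B) + wick φ (n + 1)) := by
          rw [ih, mul_add, add_mul, add_mul, mul_smul_comm, smul_mul_assoc, smul_add, ← mul_assoc]
          abel
      _ = _ := by
          rw [← hw, ← hw]
          push_cast
          module

theorem two_smul_quadrature (φ : ℝ) : (2 : ℂ) • quadrature φ =
    Complex.exp (Complex.I * φ) • creation + Complex.exp (-(Complex.I * φ)) • annihilation := by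
  rw [quadrature, smul_smul]
  norm_num

theorem wick_one (φ : ℝ) : wick φ 1 = (2 : ℂ) • quadrature φ := by
  rw [two_smul_quadrature, wick_succ, wick_zero, mul_one, one_mul]

theorem wick_add_two (φ : ℝ) (n : ℕ) : wick φ (n + 2) =
    (2 : ℂ) • quadrature φ * wick φ (n + 1) - ((n : ℂ) + 1) • wick φ n := by
  rw [two_smul_quadrature, add_mul, annihilation_mul_wick_succ, wick_succ φ (n + 1)]
  abel

/-- Both sides obey the same three-term recursion, since `V_φ` turns `2 X_φ` into multiplication by
twice the spectral variable. -/
theorem spectralRep_wick (φ : ℝ) (n : ℕ) (f : 𝓢(ℝ, ℂ)) :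
    spectralRep φ (ket (wick φ n f)) =ᵐ[volume]
      fun ξ => (hermiteFn n (2 * spectralVar φ ξ) : ℂ) * spectralRep φ (ket f) ξ := by
  have hq : ∀ g : 𝓢(ℝ, ℂ), spectralRep φ (ket (((2 : ℂ) • quadrature φ) g)) =ᵐ[volume]
      fun ξ => 2 * (spectralVar φ ξ : ℂ) * spectralRep φ (ket g) ξ := by
    intro g
    rw [smul_apply, ket_smul, map_smul]
    filter_upwards [Lp.coeFn_smul (2 : ℂ) (spectralRep φ (ket (quadrature φ g))),
      spectralRep_quadrature φ g] with ξ h1 h2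
    rw [h1, Pi.smul_apply, h2, smul_eq_mul, mul_assoc]
  induction n using Nat.twoStepInduction with
  | zero => simp [wick_zero, hermiteFn]
  | one =>
    rw [wick_one]
    filter_upwards [hq f] with ξ h
    rw [h]
    simp [hermiteFn]
  | more n ih1 ih2 =>
    have e : ket (wick φ (n + 2) f) = ket (((2 : ℂ) • quadrature φ) (wick φ (n + 1) f)) +
        (-((n : ℂ) + 1)) • ket (wick φ n f) := by
      rw [← ket_smul, ← ket_add, wick_add_two]
      congr 1
      rw [sub_apply, smul_apply, mul_apply_eq_comp]
      module
    rw [e, map_add, map_smul]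
    filter_upwards [Lp.coeFn_add
      (spectralRep φ (ket (((2 : ℂ) • quadrature φ) (wick φ (n + 1) f))))
      ((-((n : ℂ) + 1)) • spectralRep φ (ket (wick φ n f))),
      Lp.coeFn_smul (-((n : ℂ) + 1)) (spectralRep φ (ket (wick φ n f))),
      hq (wick φ (n + 1) f), ih1, ih2] with ξ h1 h2 h3 h4 h5
    rw [h1, Pi.add_apply, h2, Pi.smul_apply, h3, h4, h5, smul_eq_mul]
    simp only [hermiteFn]
    push_cast
    ring

theorem wick_vacuum (φ : ℝ) (n : ℕ) : wick φ n vacuum =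
    Complex.exp (Complex.I * φ * n) • (creation ^ n) vacuum := by
  induction n with
  | zero => simp [wick_zero]
  | succ n ih =>
    rw [wick_succ, add_apply, mul_apply_eq_comp, mul_apply_eq_comp, smul_apply, smul_apply,
      annihilation_vacuum, smul_zero, map_zero, add_zero, ih, map_smul, smul_smul,
      ← Complex.exp_add, pow_succ', mul_apply_eq_comp]
    congr 2
    push_cast
    ring

/-- On the vacuum only the `a†ⁿ` term of `:(2 X_φ)ⁿ:` survives. A Hermite factor of any degree can
thus be traded for a unit vector at the cost `√n!`. -/
theorem norm_spectralRep_fockKet (φ : ℝ) (n : ℕ) : ∀ᵐ ξ : ℝ,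
    |hermiteFn n (2 * spectralVar φ ξ)| * ‖spectralRep φ (ket vacuum) ξ‖ =
      Real.sqrt n.factorial * ‖spectralRep φ (fockKet n) ξ‖ := by
  have h := spectralRep_wick φ n vacuum
  rw [wick_vacuum, creation_pow_vacuum, smul_smul, ket_smul, map_smul] at h
  filter_upwards [h, Lp.coeFn_smul (Complex.exp (Complex.I * φ * n) *
    ((Real.sqrt n.factorial : ℝ) : ℂ)) (spectralRep φ (ket (fock n)))] with ξ h1 h2
  have h3 := congrArg norm (h2.symm.trans h1)
  have h4 : ‖Complex.exp (Complex.I * φ * n)‖ = 1 := by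
    have : Complex.I * φ * n = ((φ * n : ℝ) : ℂ) * Complex.I := by push_cast; ring
    rw [this, Complex.norm_exp_ofReal_mul_I]
  rw [Pi.smul_apply, norm_smul, norm_mul, norm_mul, h4, one_mul, Complex.norm_real,
    Complex.norm_real, Real.norm_of_nonneg (Real.sqrt_nonneg _), Real.norm_eq_abs] at h3
  exact h3.symm

/-! ### Absolute bounds for Hermite matrix elements, uniform in the angle -/

theorem integrable_norm_mul_norm (u v : Hilb) : Integrable (fun ξ : ℝ => ‖u ξ‖ * ‖v ξ‖) :=
  (Lp.memLp u).norm.integrable_mul (Lp.memLp v).norm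

theorem integral_norm_mul_norm_le (u v : Hilb) : ∫ ξ : ℝ, ‖u ξ‖ * ‖v ξ‖ ≤ ‖u‖ * ‖v‖ := by
  have e : ∀ w : Hilb, (∫ ξ : ℝ, ‖w ξ‖ ^ (2 : ℝ)) ^ (1 / 2 : ℝ) = ‖w‖ := by
    intro w
    have h1 : (∫ ξ : ℝ, ‖w ξ‖ ^ (2 : ℝ)) = ‖w‖ ^ 2 := by
      have h2 : inner ℂ w w = ((‖w‖ : ℝ) : ℂ) ^ 2 := inner_self_eq_norm_sq_to_K (𝕜 := ℂ) w
      rw [L2.inner_def] at h2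
      have h3 : ∀ ξ, inner ℂ (w ξ) (w ξ) = ((‖w ξ‖ ^ (2 : ℝ) : ℝ) : ℂ) := by
        intro ξ
        rw [Real.rpow_two, Complex.ofReal_pow]
        exact inner_self_eq_norm_sq_to_K (𝕜 := ℂ) (w ξ)
      simp_rw [h3] at h2
      rw [integral_complex_ofReal] at h2
      exact_mod_cast h2
    rw [h1, ← Real.sqrt_eq_rpow, Real.sqrt_sq (norm_nonneg w)]
  have h := integral_mul_norm_le_Lp_mul_Lq (μ := (volume : Measure ℝ)) (f := u) (g := v)
    (p := 2) (q := 2) Real.HolderConjugate.two_two (by simpa using Lp.memLp u)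
    (by simpa using Lp.memLp v)
  rwa [e, e] at h

/-- A bound, uniform in `φ`, for `(k!)^{-1/2} ‖:(2 X_φ)ᵏ: |l⟩‖`. -/
noncomputable def wickBound (k l : ℕ) : ℝ :=
  (Real.sqrt k.factorial)⁻¹ * ∑ p ∈ Finset.HasAntidiagonal.antidiagonal k,
    (k.choose p.1 : ℝ) * ‖ket ((creation ^ p.1 * annihilation ^ p.2) (fock l))‖

theorem norm_ket_wick_le (φ : ℝ) (k l : ℕ) :
    ‖ket (wick φ k (fock l))‖ ≤ Real.sqrt k.factorial * wickBound k l := by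
  have hk : Real.sqrt k.factorial ≠ 0 := (Real.sqrt_pos.2 (by positivity)).ne'
  rw [wickBound, mul_inv_cancel_left₀ hk, wick, sum_apply, ket_sum]
  refine (norm_sum_le _ _).trans (Finset.sum_le_sum fun p _ => le_of_eq ?_)
  have h4 : ‖Complex.exp (Complex.I * φ * ((p.1 : ℂ) - p.2))‖ = 1 := by
    have : Complex.I * φ * ((p.1 : ℂ) - p.2) = ((φ * (p.1 - p.2) : ℝ) : ℂ) * Complex.I := by
      push_cast; ring
    rw [this, Complex.norm_exp_ofReal_mul_I]
  rw [smul_apply, ket_smul, norm_smul, norm_mul, h4, mul_one, Complex.norm_natCast]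

/-- The integrand of `⟨k| He_n(2 X_φ) |l⟩` in the spectral representation. -/
noncomputable def hermiteIntegrand (φ : ℝ) (n k l : ℕ) (ξ : ℝ) : ℂ :=
  (starRingEnd ℂ) (spectralRep φ (fockKet k) ξ) *
    ((hermiteFn n (2 * spectralVar φ ξ) : ℂ) * spectralRep φ (fockKet l) ξ)

/-- Write `ψ_j` for the transformed number states. Since `|ψ_k| = |He_k||ψ_0|/√k!` and `|He_n||ψ_0|
= √n! |ψ_n|`, the large index `n` moves into the unit vector `ψ_n`, and the fixed polynomial `He_k`
is left on `ψ_l`. Bounding `He_n ψ_l` in norm directly would be less sharp. -/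
theorem norm_hermiteIntegrand (φ : ℝ) (n k l : ℕ) : ∀ᵐ ξ : ℝ,
    ‖hermiteIntegrand φ n k l ξ‖ = Real.sqrt n.factorial * (Real.sqrt k.factorial)⁻¹ *
      (‖spectralRep φ (fockKet n) ξ‖ * ‖spectralRep φ (ket (wick φ k (fock l))) ξ‖) := by
  filter_upwards [norm_spectralRep_fockKet φ n, norm_spectralRep_fockKet φ k,
    spectralRep_wick φ k (fock l)] with ξ h1 h2 h3
  have hk : Real.sqrt k.factorial ≠ 0 := (Real.sqrt_pos.2 (by positivity)).ne'
  have h4 : ‖spectralRep φ (ket (wick φ k (fock l))) ξ‖ =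
      |hermiteFn k (2 * spectralVar φ ξ)| * ‖spectralRep φ (fockKet l) ξ‖ := by
    rw [h3, norm_mul, Complex.norm_real, Real.norm_eq_abs]
    rfl
  rw [h4, hermiteIntegrand, norm_mul, norm_mul, RCLike.norm_conj, Complex.norm_real,
    Real.norm_eq_abs]
  field_simp
  linear_combination (-|hermiteFn n (2 * spectralVar φ ξ)|) * ‖spectralRep φ (fockKet l) ξ‖ * h2
    + |hermiteFn k (2 * spectralVar φ ξ)| * ‖spectralRep φ (fockKet l) ξ‖ * h1

theorem aestronglyMeasurable_hermiteIntegrand (φ : ℝ) (n k l : ℕ) :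
    AEStronglyMeasurable (hermiteIntegrand φ n k l) volume := by
  have hs : Continuous (spectralVar φ) := by
    unfold spectralVar
    split_ifs <;> fun_prop
  have hh : Continuous (fun ξ => (hermiteFn n (2 * spectralVar φ ξ) : ℂ)) :=
    Complex.continuous_ofReal.comp ((continuous_hermiteFn n).comp (continuous_const.mul hs))
  exact (RCLike.continuous_conj.comp_aestronglyMeasurable (Lp.aestronglyMeasurable _)).mul
    (hh.aestronglyMeasurable.mul (Lp.aestronglyMeasurable _))

theorem integrable_hermiteIntegrand (φ : ℝ) (n k l : ℕ) :
    Integrable (hermiteIntegrand φ n k l) := by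
  refine ((integrable_norm_mul_norm (spectralRep φ (fockKet n))
    (spectralRep φ (ket (wick φ k (fock l))))).const_mul
      (Real.sqrt n.factorial * (Real.sqrt k.factorial)⁻¹)).mono'
    (aestronglyMeasurable_hermiteIntegrand φ n k l) ?_
  filter_upwards [norm_hermiteIntegrand φ n k l] with ξ h
  exact h.le

theorem integral_norm_hermiteIntegrand_le (φ : ℝ) (n k l : ℕ) :
    ∫ ξ, ‖hermiteIntegrand φ n k l ξ‖ ≤ Real.sqrt n.factorial * wickBound k l := by
  have hk : Real.sqrt k.factorial ≠ 0 := (Real.sqrt_pos.2 (by positivity)).ne'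
  rw [integral_congr_ae (norm_hermiteIntegrand φ n k l), integral_const_mul, mul_assoc]
  refine mul_le_mul_of_nonneg_left ?_ (Real.sqrt_nonneg _)
  have h := integral_norm_mul_norm_le (spectralRep φ (fockKet n))
    (spectralRep φ (ket (wick φ k (fock l))))
  rw [LinearIsometryEquiv.norm_map, LinearIsometryEquiv.norm_map, norm_fockKet, one_mul] at h
  refine (mul_le_mul_of_nonneg_left (h.trans (norm_ket_wick_le φ k l))
    (inv_nonneg.2 (Real.sqrt_nonneg _))).trans (le_of_eq ?_)
  rw [inv_mul_cancel_left₀ hk]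

theorem integral_hermiteIntegrand (φ : ℝ) (n k l : ℕ) :
    ∫ ξ, hermiteIntegrand φ n k l ξ = ∑ p ∈ Finset.HasAntidiagonal.antidiagonal n,
      (n.choose p.1 : ℂ) * Complex.exp (Complex.I * φ * ((p.1 : ℂ) - p.2)) *
        monomialElement p.1 p.2 k l := by
  have h1 : ∫ ξ, hermiteIntegrand φ n k l ξ = inner ℂ (fockKet k) (ket (wick φ n (fock l))) := by
    rw [← (spectralRep φ).inner_map_map, L2.inner_def]
    refine integral_congr_ae ?_
    filter_upwards [spectralRep_wick φ n (fock l)] with ξ h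
    rw [h, RCLike.inner_apply, hermiteIntegrand, mul_comm]
    rfl
  rw [h1, wick, sum_apply, ket_sum, inner_sum]
  refine Finset.sum_congr rfl fun p _ => ?_
  rw [smul_apply, ket_smul, inner_smul_right]
  rfl

/-! ### Coherent states and the operator-norm derivative defining `G` -/

theorem pow_le_sqrt_factorial_mul_exp (r : ℝ) (n : ℕ) :
    |r| ^ n ≤ Real.sqrt n.factorial * Real.exp (r ^ 2 / 2) := by
  have hf : (0 : ℝ) < n.factorial := by positivity
  have h := Real.pow_div_factorial_le_exp (r ^ 2) (sq_nonneg r) n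
  rw [div_le_iff₀ hf] at h
  refine abs_le_of_sq_le_sq' ?_ (by positivity) |>.2
  rw [mul_pow, Real.sq_sqrt hf.le, ← Real.exp_nat_mul, ← pow_mul, mul_comm n 2, pow_mul, sq_abs]
  have e : ((2 : ℕ) : ℝ) * (r ^ 2 / 2) = r ^ 2 := by push_cast; ring
  rw [e]
  linarith

theorem summable_pow_div_sqrt_factorial (r : ℝ) :
    Summable (fun n : ℕ => |r| ^ n / Real.sqrt n.factorial) := by
  refine Summable.of_nonneg_of_le (fun n => by positivity) (fun n => ?_)
    (summable_geometric_two.mul_left (Real.exp ((2 * r) ^ 2 / 2)))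
  have hf : 0 < Real.sqrt n.factorial := Real.sqrt_pos.2 (by positivity)
  -- Using the bound at `2r` instead of `r` gains the geometric factor `2⁻ⁿ`.
  have h := pow_le_sqrt_factorial_mul_exp (2 * r) n
  rw [abs_mul, abs_two, mul_pow] at h
  have h2 : (0 : ℝ) < 2 ^ n := by positivity
  rw [div_le_iff₀ hf, one_div, inv_pow, ← div_eq_mul_inv, div_mul_eq_mul_div, le_div_iff₀ h2]
  linarith

/-- The unnormalized coherent state `∑ₙ αⁿ/√n! |n⟩`. -/
noncomputable def coherentSeries (α : ℂ) : Hilb :=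
  ∑' n : ℕ, (α ^ n / ((Real.sqrt n.factorial : ℝ) : ℂ)) • fockKet n

theorem norm_coherentSeries_term (α : ℂ) (n : ℕ) :
    ‖(α ^ n / ((Real.sqrt n.factorial : ℝ) : ℂ)) • fockKet n‖ =
      ‖α‖ ^ n / Real.sqrt n.factorial := by
  rw [norm_smul, norm_fockKet, mul_one, norm_div, norm_pow, Complex.norm_real,
    Real.norm_of_nonneg (Real.sqrt_nonneg _)]

theorem summable_coherentSeries (α : ℂ) :
    Summable fun n : ℕ => (α ^ n / ((Real.sqrt n.factorial : ℝ) : ℂ)) • fockKet n := by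
  refine Summable.of_norm ?_
  simp_rw [norm_coherentSeries_term]
  simpa using summable_pow_div_sqrt_factorial ‖α‖

theorem differentiable_coherentSeries : Differentiable ℂ coherentSeries := by
  intro α
  have h : DifferentiableOn ℂ coherentSeries (Metric.ball 0 (‖α‖ + 1)) := by
    refine Complex.differentiableOn_tsum_of_summable_norm
      (u := fun n => |‖α‖ + 1| ^ n / Real.sqrt n.factorial)
      (summable_pow_div_sqrt_factorial _) (fun n => ?_) Metric.isOpen_ball (fun n w hw => ?_)
    · exact (Differentiable.smul_const (by fun_prop) _).differentiableOn
    · rw [norm_coherentSeries_term]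
      have hw' : ‖w‖ ≤ |‖α‖ + 1| := by
        rw [abs_of_nonneg (by positivity)]
        exact (mem_ball_zero_iff.1 hw).le
      gcongr
  exact h.differentiableAt (Metric.isOpen_ball.mem_nhds (by simp))

theorem contDiff_coherentSeries : ContDiff ℝ 1 coherentSeries :=
  (differentiable_coherentSeries.contDiff (n := 1)).restrict_scalars ℝ

theorem inner_coherentSeries (e : Hilb) (α : ℂ) : inner ℂ e (coherentSeries α) =
    ∑' n : ℕ, (α ^ n / ((Real.sqrt n.factorial : ℝ) : ℂ)) * inner ℂ e (fockKet n) := by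
  have h := (innerSL ℂ e).map_tsum (summable_coherentSeries α)
  simp only [innerSL_apply_apply, inner_smul_right] at h
  exact h

theorem inner_fockKet_coherentSeries (k : ℕ) (α : ℂ) :
    inner ℂ (fockKet k) (coherentSeries α) = α ^ k / ((Real.sqrt k.factorial : ℝ) : ℂ) := by
  rw [inner_coherentSeries, tsum_eq_single k]
  · rw [inner_fockKet, if_pos rfl, mul_one]
  · intro n hn
    rw [inner_fockKet, if_neg hn.symm, mul_zero]

/-- The dyad is conjugate-linear in its second vector, hence bilinear only over `ℝ`; this suffices
for smoothness in the real variables `t` and `θ`. -/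
theorem isBoundedBilinearMap_rankOne : IsBoundedBilinearMap ℝ
    (fun p : Hilb × Hilb => (InnerProductSpace.rankOne ℂ p.1 p.2 : Hilb →L[ℂ] Hilb)) where
  add_left x y z := by simp
  smul_left c x y := by
    have h : c • x = (c : ℂ) • x := RCLike.real_smul_eq_coe_smul (K := ℂ) c x
    change InnerProductSpace.rankOne ℂ (c • x) y = c • InnerProductSpace.rankOne ℂ x y
    rw [h, map_smul, smul_apply]
    exact Complex.coe_smul c (InnerProductSpace.rankOne ℂ x y)
  add_right x y z := by simp
  smul_right c x y := by
    have h : c • y = (c : ℂ) • y := RCLike.real_smul_eq_coe_smul (K := ℂ) c y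
    change InnerProductSpace.rankOne ℂ x (c • y) = c • InnerProductSpace.rankOne ℂ x y
    rw [h, ContinuousLinearMap.map_smulₛₗ, Complex.conj_ofReal]
    exact Complex.coe_smul c (InnerProductSpace.rankOne ℂ x y)
  bound := ⟨1, one_pos, fun x y => by simp⟩

/-- `e^{t²θ(1-θ)} |E(i(1-θ)te^{iφ})⟩⟨E(-iθte^{iφ})|` with the unnormalized coherent states `E`. -/
noncomputable def dyadKernel (φ t θ : ℝ) : Hilb →L[ℂ] Hilb :=
  ((Real.exp (t ^ 2 * (θ * (1 - θ))) : ℝ) : ℂ) • InnerProductSpace.rankOne ℂ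
    (coherentSeries (Complex.I * (1 - θ) * t * Complex.exp (Complex.I * φ)))
    (coherentSeries (-Complex.I * θ * t * Complex.exp (Complex.I * φ)))

set_option maxHeartbeats 400000 in
theorem contDiff_dyadKernel (φ : ℝ) :
    ContDiff ℝ 1 (fun p : ℝ × ℝ => dyadKernel φ p.1 p.2) := by
  have h0 : ContDiff ℝ 1 (fun p : ℝ × ℝ => (p.1 : ℂ)) :=
    Complex.ofRealCLM.contDiff.comp contDiff_fst
  have h1 : ContDiff ℝ 1 (fun p : ℝ × ℝ => (p.2 : ℂ)) :=
    Complex.ofRealCLM.contDiff.comp contDiff_snd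
  have h2 : ContDiff ℝ 1 (fun p : ℝ × ℝ =>
      Complex.I * (1 - p.2) * p.1 * Complex.exp (Complex.I * φ)) := by
    fun_prop
  have h3 : ContDiff ℝ 1 (fun p : ℝ × ℝ =>
      -Complex.I * p.2 * p.1 * Complex.exp (Complex.I * φ)) := by
    fun_prop
  have h4 : ContDiff ℝ 1 (fun p : ℝ × ℝ => Real.exp (p.1 ^ 2 * (p.2 * (1 - p.2)))) := by
    fun_prop
  have h5 : ContDiff ℝ 1 (fun p : ℝ × ℝ => ((Real.exp (p.1 ^ 2 * (p.2 * (1 - p.2))) : ℝ) : ℂ)) :=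
    Complex.ofRealCLM.contDiff.comp h4
  have h6 : ContDiff ℝ 1 (fun p : ℝ × ℝ =>
      (coherentSeries (Complex.I * (1 - p.2) * p.1 * Complex.exp (Complex.I * φ)),
        coherentSeries (-Complex.I * p.2 * p.1 * Complex.exp (Complex.I * φ)))) :=
    (contDiff_coherentSeries.comp h2).prodMk (contDiff_coherentSeries.comp h3)
  have h7 := (isBoundedBilinearMap_rankOne.contDiff (n := 1)).comp h6
  have h8 := h5.smul h7
  exact h8

theorem continuous_dyadKernel (φ t : ℝ) : Continuous (dyadKernel φ t) :=
  (contDiff_dyadKernel φ).continuous.comp (f := fun θ : ℝ => (t, θ))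
    (continuous_const.prodMk continuous_id)

/-- The normalizing exponents add up by `(1-θ)² + θ² = 1 - 2θ(1-θ)`. The resulting `e^{-t²/2}` is
what the prefactor of `primitiveG` removes. -/
theorem coherentDyad_eq (φ t θ : ℝ) :
    coherentDyad φ t θ = ((Real.exp (-t ^ 2 / 2) : ℝ) : ℂ) • dyadKernel φ t θ := by
  have hc : ∀ α, coherent α = ((Real.exp (-‖α‖ ^ 2 / 2) : ℝ) : ℂ) • coherentSeries α :=
    fun _ => rfl
  have hn : ‖Complex.exp (Complex.I * φ)‖ = 1 := by
    rw [mul_comm, Complex.norm_exp_ofReal_mul_I]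
  have h1 : ‖Complex.I * (1 - θ) * t * Complex.exp (Complex.I * φ)‖ ^ 2 =
      (1 - θ) ^ 2 * t ^ 2 := by
    have : (1 - (θ : ℂ)) = ((1 - θ : ℝ) : ℂ) := by push_cast; rfl
    rw [norm_mul, norm_mul, norm_mul, hn, Complex.norm_I, this, Complex.norm_real,
      Complex.norm_real, Real.norm_eq_abs, Real.norm_eq_abs, one_mul, mul_one, mul_pow, sq_abs,
      sq_abs]
  have h2 : ‖-Complex.I * θ * t * Complex.exp (Complex.I * φ)‖ ^ 2 = θ ^ 2 * t ^ 2 := by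
    rw [norm_mul, norm_mul, norm_mul, hn, norm_neg, Complex.norm_I, Complex.norm_real,
      Complex.norm_real, Real.norm_eq_abs, Real.norm_eq_abs, one_mul, mul_one, mul_pow, sq_abs,
      sq_abs]
  rw [coherentDyad, dyadKernel, hc, hc, (InnerProductSpace.rankOne ℂ).map_smul, smul_apply,
    ContinuousLinearMap.map_smulₛₗ, Complex.conj_ofReal, h1, h2, smul_smul, smul_smul,
    ← Complex.ofReal_mul, ← Complex.ofReal_mul, ← Real.exp_add, ← Real.exp_add]
  congr 3
  ring

theorem intervalIntegrable_coherentDyad (φ t : ℝ) :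
    IntervalIntegrable (coherentDyad φ t) volume 0 1 := by
  rw [funext (coherentDyad_eq φ t)]
  exact ((continuous_dyadKernel φ t).const_smul
    ((Real.exp (-t ^ 2 / 2) : ℝ) : ℂ)).intervalIntegrable 0 1

theorem primitiveG_eq (φ t : ℝ) :
    primitiveG φ t = (t : ℂ) • ∫ θ in (0 : ℝ)..1, dyadKernel φ t θ := by
  rw [primitiveG, funext (coherentDyad_eq φ t), intervalIntegral.integral_smul,
    smul_smul, ← Complex.ofReal_mul, mul_assoc, ← Real.exp_add,
    show t ^ 2 / 2 + -t ^ 2 / 2 = 0 by ring, Real.exp_zero, mul_one]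

theorem hasDerivAt_intervalIntegral_of_contDiff {E : Type*} [NormedAddCommGroup E]
    [NormedSpace ℝ E] {F : ℝ → ℝ → E} {F' : ℝ → ℝ → E}
    (hF : ContDiff ℝ 1 (fun p : ℝ × ℝ => F p.1 p.2))
    (hF' : ∀ t θ, HasDerivAt (fun s => F s θ) (F' t θ) t) (t : ℝ) :
    HasDerivAt (fun s => ∫ θ in (0 : ℝ)..1, F s θ) (∫ θ in (0 : ℝ)..1, F' t θ) t := by
  -- Identifying `F'` with a partial derivative of a jointly `C¹` map makes it jointly continuous,
  -- hence bounded on a compact neighbourhood, which gives the dominating constant.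
  have e : ∀ t θ, F' t θ = fderiv ℝ (fun p : ℝ × ℝ => F p.1 p.2) (t, θ) (1, 0) := by
    intro t θ
    have h1 : HasDerivAt (fun s : ℝ => (s, θ)) ((1 : ℝ), (0 : ℝ)) t :=
      (hasDerivAt_id t).prodMk (hasDerivAt_const t θ)
    have h2 := ((hF.differentiable one_ne_zero (t, θ)).hasFDerivAt.comp_hasDerivAt t h1)
    exact (hF' t θ).unique h2
  have hc : Continuous (fun p : ℝ × ℝ => F' p.1 p.2) := by
    simp_rw [e]
    exact (hF.continuous_fderiv one_ne_zero).clm_apply continuous_const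
  have hF0 : ∀ s, Continuous (F s) := fun s =>
    hF.continuous.comp (f := fun θ : ℝ => (s, θ)) (continuous_const.prodMk continuous_id)
  have hF1 : ∀ s, Continuous (F' s) := fun s =>
    hc.comp (f := fun θ : ℝ => (s, θ)) (continuous_const.prodMk continuous_id)
  obtain ⟨M, hM⟩ := ((isCompact_closedBall t 1).prod (isCompact_Icc (a := (0 : ℝ)) (b := 1)))
    |>.exists_bound_of_continuousOn hc.continuousOn
  refine (intervalIntegral.hasDerivAt_integral_of_dominated_loc_of_deriv_le
    (F := F) (F' := F') (x₀ := t) (bound := fun _ => M)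
    (Metric.closedBall_mem_nhds t one_pos)
    (Filter.Eventually.of_forall fun s => (hF0 s).aestronglyMeasurable)
    ((hF0 t).intervalIntegrable 0 1) (hF1 t).aestronglyMeasurable
    (Filter.Eventually.of_forall fun θ hθ s hs => ?_) intervalIntegrable_const
    (Filter.Eventually.of_forall fun θ _ s _ => hF' s θ)).2
  rw [Set.uIoc_of_le zero_le_one] at hθ
  exact hM (s, θ) ⟨hs, Set.Ioc_subset_Icc_self hθ⟩

theorem differentiable_primitiveG (φ : ℝ) : Differentiable ℝ (primitiveG φ) := by
  rw [funext (primitiveG_eq φ)]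
  have h0 : Differentiable ℝ (fun t : ℝ => (t : ℂ)) := Complex.ofRealCLM.differentiable
  refine h0.smul fun t => ?_
  have hd : ∀ t θ : ℝ, DifferentiableAt ℝ (fun s => dyadKernel φ s θ) t := fun t θ =>
    (((contDiff_dyadKernel φ).differentiable one_ne_zero).comp (f := fun s : ℝ => (s, θ))
      (differentiable_id.prodMk (differentiable_const θ))) t
  exact (hasDerivAt_intervalIntegral_of_contDiff (contDiff_dyadKernel φ)
    (fun t θ => (hd t θ).hasDerivAt) t).differentiableAt

theorem hasDerivAt_primitiveG (φ t : ℝ) : HasDerivAt (primitiveG φ) (opG t φ) t :=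
  (differentiable_primitiveG φ t).hasDerivAt

theorem inner_primitiveG (φ t : ℝ) (e v : Hilb) : inner ℂ e (primitiveG φ t v) =
    (t : ℂ) * ∫ θ in (0 : ℝ)..1, inner ℂ e (dyadKernel φ t θ v) := by
  have h := ((innerSL ℂ e).comp (ContinuousLinearMap.apply ℂ Hilb v)).intervalIntegral_comp_comm
    ((continuous_dyadKernel φ t).intervalIntegrable (μ := volume) 0 1)
  simp only [ContinuousLinearMap.comp_apply, ContinuousLinearMap.apply_apply,
    innerSL_apply_apply] at h
  rw [h, primitiveG_eq, smul_apply, inner_smul_right]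

theorem hasDerivAt_inner_primitiveG (φ t : ℝ) (e v : Hilb) :
    HasDerivAt (fun s => inner ℂ e (primitiveG φ s v)) (inner ℂ e (opG t φ v)) t :=
  (((innerSL ℂ e).comp (ContinuousLinearMap.apply ℂ Hilb v)).restrictScalars
    ℝ).hasFDerivAt.comp_hasDerivAt t (hasDerivAt_primitiveG φ t)

theorem inner_dyadKernel (φ t θ : ℝ) (e v : Hilb) : inner ℂ e (dyadKernel φ t θ v) =
    ((Real.exp (t ^ 2 * (θ * (1 - θ))) : ℝ) : ℂ) *
      (inner ℂ (coherentSeries (-Complex.I * θ * t * Complex.exp (Complex.I * φ))) v *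
      inner ℂ e (coherentSeries (Complex.I * (1 - θ) * t * Complex.exp (Complex.I * φ)))) := by
  rw [dyadKernel, smul_apply, inner_smul_right,
    InnerProductSpace.rankOne_apply, inner_smul_right]

/-- The range of `G(t,φ)` lies in the closed span of the number states. -/
theorem inner_opG_eq_zero (φ t : ℝ) {e : Hilb} (he : ∀ k, inner ℂ (fockKet k) e = 0) (v : Hilb) :
    inner ℂ (opG t φ v) e = 0 := by
  have h0 : ∀ α, inner ℂ e (coherentSeries α) = 0 := by
    intro α
    rw [inner_coherentSeries]
    have : ∀ n, inner ℂ e (fockKet n) = 0 := fun n => by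
      rw [← inner_conj_symm, he, map_zero]
    simp [this]
  have h1 : (fun s => inner ℂ e (primitiveG φ s v)) = fun _ => (0 : ℂ) := by
    funext s
    rw [inner_primitiveG]
    simp [inner_dyadKernel, h0]
  have h2 := hasDerivAt_inner_primitiveG φ t e v
  rw [h1] at h2
  rw [← inner_conj_symm, h2.unique (hasDerivAt_const t 0), map_zero]

/-! ### Number-basis elements of `G` and the Beta integral -/

/-- Completeness of the number states is not needed. They extend to some Hilbert basis, and the
added vectors are orthogonal to `v` by hypothesis, so Parseval's sum reduces to the number states.
-/
theorem hasSum_inner_fockKet (v w : Hilb)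
    (hv : ∀ e, (∀ k, inner ℂ (fockKet k) e = 0) → inner ℂ v e = 0) :
    HasSum (fun k => inner ℂ v (fockKet k) * inner ℂ (fockKet k) w) (inner ℂ v w) := by
  obtain ⟨s, b, hs, hb⟩ := orthonormal_fockKet.toSubtypeRange.exists_hilbertBasis_extension
  have h := b.hasSum_inner_mul_inner v w
  have hinj : Function.Injective
      (fun k : ℕ => (⟨fockKet k, hs (Set.mem_range_self k)⟩ : s)) := by
    intro j k hjk
    exact orthonormal_fockKet.linearIndependent.injective (congrArg Subtype.val hjk)
  rw [hb] at h
  refine (hinj.hasSum_iff fun x hx => ?_).2 h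
  have hx0 : inner ℂ v (x : Hilb) = 0 := by
    refine hv x fun k => ?_
    have ho := b.orthonormal.2 (i := ⟨fockKet k, hs (Set.mem_range_self k)⟩) (j := x)
      (fun h => hx ⟨k, h⟩)
    rwa [hb] at ho
  rw [hx0, zero_mul]

/-- The integrand of the matrix elements of `G(t,φ)`, up to a constant phase. -/
noncomputable def elementIntegrand (k n : ℕ) (t θ : ℝ) : ℝ :=
  ((k + n + 1 : ℕ) + 2 * (t ^ 2 * (θ * (1 - θ)))) * t ^ (k + n) *
    Real.exp (t ^ 2 * (θ * (1 - θ))) * ((1 - θ) ^ k * θ ^ n)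

/-- Overlaps of number states with unnormalized coherent states are monomials, so before
differentiation the element is a constant phase times a real integral over `θ`, which is then
differentiated in `t`. -/
theorem inner_opG_fockKet (φ t : ℝ) (k n : ℕ) : inner ℂ (opG t φ (fockKet n)) (fockKet k) =
    (-Complex.I) ^ (k + n) * Complex.exp (Complex.I * φ * ((n : ℂ) - k)) /
      (((Real.sqrt k.factorial : ℝ) : ℂ) * ((Real.sqrt n.factorial : ℝ) : ℂ)) *
      ((∫ θ in (0 : ℝ)..1, elementIntegrand k n t θ : ℝ) : ℂ) := by
  set F : ℝ → ℝ → ℝ := fun s θ =>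
    s ^ (k + n + 1) * Real.exp (s ^ 2 * (θ * (1 - θ))) * ((1 - θ) ^ k * θ ^ n) with hF
  set κ : ℂ := Complex.I ^ (k + n) * Complex.exp (Complex.I * φ * ((k : ℂ) - n)) /
      (((Real.sqrt k.factorial : ℝ) : ℂ) * ((Real.sqrt n.factorial : ℝ) : ℂ)) with hκ
  have hd : HasDerivAt (fun s => ∫ θ in (0 : ℝ)..1, F s θ)
      (∫ θ in (0 : ℝ)..1, elementIntegrand k n t θ) t := by
    refine hasDerivAt_intervalIntegral_of_contDiff ?_ (fun s θ => ?_) t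
    · simp only [hF]
      fun_prop
    · have h1 := hasDerivAt_pow (k + n + 1) s
      have h2 := ((hasDerivAt_pow 2 s).mul_const (θ * (1 - θ))).exp
      refine ((h1.mul h2).mul_const ((1 - θ) ^ k * θ ^ n)).congr_deriv ?_
      rw [elementIntegrand, Nat.add_sub_cancel]
      push_cast
      ring
  have hp : ∀ s : ℝ, inner ℂ (fockKet k) (primitiveG φ s (fockKet n)) =
      κ * ((∫ θ in (0 : ℝ)..1, F s θ : ℝ) : ℂ) := by
    intro s
    have hθ : ∀ θ : ℝ, inner ℂ (fockKet k) (dyadKernel φ s θ (fockKet n)) =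
        κ * (((Real.exp (s ^ 2 * (θ * (1 - θ))) * s ^ (k + n) *
          ((1 - θ) ^ k * θ ^ n) : ℝ)) : ℂ) := by
      intro θ
      have hexp : Complex.exp (Complex.I * φ * ((k : ℂ) - n)) =
          Complex.exp (Complex.I * φ) ^ k * Complex.exp (-(Complex.I * φ)) ^ n := by
        rw [← Complex.exp_nat_mul, ← Complex.exp_nat_mul, ← Complex.exp_add]
        congr 1
        ring
      rw [inner_dyadKernel, ← inner_conj_symm _ (fockKet n), inner_fockKet_coherentSeries,
        inner_fockKet_coherentSeries, hκ, hexp, map_div₀, map_pow, Complex.conj_ofReal]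
      simp only [map_mul, map_neg, Complex.conj_I, Complex.conj_ofReal, ← Complex.exp_conj, neg_neg]
      push_cast
      simp only [mul_pow, pow_add, neg_mul]
      ring
    rw [inner_primitiveG]
    simp_rw [hθ]
    rw [intervalIntegral.integral_const_mul, intervalIntegral.integral_ofReal, mul_left_comm,
      ← Complex.ofReal_mul, ← intervalIntegral.integral_const_mul]
    congr 3
    funext θ
    rw [hF]
    ring
  have h := hasDerivAt_inner_primitiveG φ t (fockKet k) (fockKet n)
  rw [funext hp] at h
  -- The derivative gives `⟨k|G|n⟩`; its conjugate is the element of `G†`, which turns `i` into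
  -- `-i`.
  rw [← inner_conj_symm, h.unique (hd.ofReal_comp.const_mul κ), map_mul, Complex.conj_ofReal, hκ,
    map_div₀, map_mul, map_mul, map_pow, Complex.conj_ofReal, Complex.conj_ofReal,
    Complex.conj_I, ← Complex.exp_conj]
  congr 4
  simp only [map_mul, map_sub, Complex.conj_I, Complex.conj_ofReal, map_natCast]
  ring

theorem integral_one_sub_pow_mul_pow (m q : ℕ) :
    ∫ θ in (0 : ℝ)..1, (1 - θ) ^ m * θ ^ q =
      (((m + q : ℕ) : ℝ) + 1)⁻¹ * ((m + q).choose m : ℝ)⁻¹ := by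
  have h := Complex.Gamma_mul_Gamma_eq_betaIntegral (s := (q : ℂ) + 1) (t := (m : ℂ) + 1)
    (by simp; positivity) (by simp; positivity)
  have hb : Complex.betaIntegral ((q : ℂ) + 1) ((m : ℂ) + 1) =
      ((∫ θ in (0 : ℝ)..1, (1 - θ) ^ m * θ ^ q : ℝ) : ℂ) := by
    rw [Complex.betaIntegral, ← intervalIntegral.integral_ofReal]
    congr 1
    funext θ
    rw [add_sub_cancel_right, add_sub_cancel_right, Complex.cpow_natCast, Complex.cpow_natCast]
    push_cast
    ring
  have e : (q : ℂ) + 1 + ((m : ℂ) + 1) = ((m + q + 1 : ℕ) : ℂ) + 1 := by push_cast; ring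
  rw [hb, e, Complex.Gamma_nat_eq_factorial, Complex.Gamma_nat_eq_factorial,
    Complex.Gamma_nat_eq_factorial, Nat.factorial_succ] at h
  have h' : (q.factorial : ℝ) * m.factorial = ((m + q + 1) * (m + q).factorial : ℕ) *
      ∫ θ in (0 : ℝ)..1, (1 - θ) ^ m * θ ^ q := by exact_mod_cast h
  have hc : ((m + q).choose m : ℝ) * m.factorial * q.factorial = (m + q).factorial := by
    rw [Nat.choose_symm_add]
    exact_mod_cast Nat.add_choose_mul_factorial_mul_factorial m q
  have h1 : ((m + q).choose m : ℝ) ≠ 0 := by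
    exact_mod_cast (Nat.choose_pos (Nat.le_add_right m q)).ne'
  have h2 : (m.factorial : ℝ) ≠ 0 := by exact_mod_cast m.factorial_ne_zero
  have h3 : (q.factorial : ℝ) ≠ 0 := by exact_mod_cast q.factorial_ne_zero
  have h4 : ((m + q : ℕ) : ℝ) + 1 ≠ 0 := by positivity
  rw [← mul_inv]
  apply eq_inv_of_mul_eq_one_left
  apply mul_left_cancel₀ (mul_ne_zero h2 h3)
  push_cast at h' h4 ⊢
  rw [← hc] at h'
  linear_combination -h'

/-- The coefficient of `F(t,φ)` in the expansion of `a†ᵐ a^q`. -/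
noncomputable def monomialCoeff (m q : ℕ) (φ t : ℝ) : ℂ :=
  Complex.exp (Complex.I * φ * ((q : ℂ) - m)) * ((m + q).choose m : ℂ)⁻¹ *
    (-Complex.I * t) ^ (m + q)

theorem norm_exp_I_mul_sub (φ : ℝ) (m q : ℕ) :
    ‖Complex.exp (Complex.I * φ * ((q : ℂ) - m))‖ = 1 := by
  have : Complex.I * φ * ((q : ℂ) - m) = ((φ * (q - m) : ℝ) : ℂ) * Complex.I := by
    push_cast; ring
  rw [this, Complex.norm_exp_ofReal_mul_I]

/-- The bracket is a multiple of `t^{m+q+1}`; differentiation supplies the factor `m+q+1`, which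
cancels the one in the Beta integral and leaves the inverse binomial. -/
theorem deriv_bracket (m q : ℕ) (φ t : ℝ) :
    deriv (fun s : ℝ => (s : ℂ) * ∫ θ in (0 : ℝ)..1,
      (-Complex.I * θ * s * Complex.exp (Complex.I * φ)) ^ q *
      (-Complex.I * (1 - θ) * s * Complex.exp (-(Complex.I * φ))) ^ m) t =
    monomialCoeff m q φ t := by
  have hexp : Complex.exp (Complex.I * φ * ((q : ℂ) - m)) =
      Complex.exp (Complex.I * φ) ^ q * Complex.exp (-(Complex.I * φ)) ^ m := by
    rw [← Complex.exp_nat_mul, ← Complex.exp_nat_mul, ← Complex.exp_add]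
    congr 1
    ring
  have e : (fun s : ℝ => (s : ℂ) * ∫ θ in (0 : ℝ)..1,
      (-Complex.I * θ * s * Complex.exp (Complex.I * φ)) ^ q *
      (-Complex.I * (1 - θ) * s * Complex.exp (-(Complex.I * φ))) ^ m) =
      fun s : ℝ => (Complex.exp (Complex.I * φ * ((q : ℂ) - m)) * (-Complex.I) ^ (m + q) *
        (((((m + q : ℕ) : ℝ) + 1)⁻¹ * ((m + q).choose m : ℝ)⁻¹ : ℝ) : ℂ)) *
        (s : ℂ) ^ (m + q + 1) := by
    funext s
    rw [← integral_one_sub_pow_mul_pow, ← intervalIntegral.integral_ofReal, mul_right_comm,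
      ← intervalIntegral.integral_const_mul, ← intervalIntegral.integral_const_mul]
    congr 1
    funext θ
    rw [hexp]
    push_cast
    simp only [mul_pow, pow_add, pow_one]
    ring
  have hd : HasDerivAt (fun s : ℝ => (s : ℂ) ^ (m + q + 1))
      (((m + q + 1 : ℕ) : ℂ) * (t : ℂ) ^ (m + q + 1 - 1) * 1) t :=
    (Complex.ofRealCLM.hasDerivAt (x := t)).fun_pow (m + q + 1)
  have h4 : ((m : ℂ) + q) + 1 ≠ 0 := by exact_mod_cast Nat.succ_ne_zero (m + q)
  rw [e, (hd.const_mul _).deriv, monomialCoeff, Nat.add_sub_cancel, mul_pow]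
  push_cast
  field_simp

/-! ### The trace against normal-ordered operators -/

/-- The radial part of the `s`-th diagonal contribution to `Tr[G† a†ᵐ a^q]`. -/
noncomputable def radialElement (m q s : ℕ) (t : ℝ) : ℝ :=
  ∫ θ in (0 : ℝ)..1, (((m + q : ℕ) : ℝ) + 1 + 2 * s + 2 * (t ^ 2 * (θ * (1 - θ)))) *
    (t ^ 2 * (θ * (1 - θ))) ^ s * Real.exp (t ^ 2 * (θ * (1 - θ))) * ((1 - θ) ^ m * θ ^ q)

theorem integral_elementIntegrand (m q s : ℕ) (t : ℝ) :
    ∫ θ in (0 : ℝ)..1, elementIntegrand (m + s) (q + s) t θ =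
      t ^ (m + q) * radialElement m q s t := by
  rw [radialElement, ← intervalIntegral.integral_const_mul]
  congr 1
  funext θ
  rw [elementIntegrand, mul_pow (t ^ 2) (θ * (1 - θ)) s, mul_pow θ (1 - θ) s]
  push_cast
  ring

theorem hasSum_exp_mul_affine (ε w b : ℝ) :
    HasSum (fun s : ℕ => ε ^ s / s.factorial * ((b + 2 * s) * w ^ s))
      (Real.exp (ε * w) * (b + 2 * (ε * w))) := by
  have h0 : HasSum (fun s : ℕ => (ε * w) ^ s / s.factorial) (Real.exp (ε * w)) := by
    rw [Real.exp_eq_exp_ℝ]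
    exact NormedSpace.expSeries_div_hasSum_exp (ε * w)
  have h1 : HasSum (fun s : ℕ => (s : ℝ) * ((ε * w) ^ s / s.factorial))
      (ε * w * Real.exp (ε * w)) := by
    rw [← hasSum_nat_add_iff' 1]
    simp only [Finset.range_one, Finset.sum_singleton, Nat.cast_zero, zero_mul, sub_zero]
    refine (h0.mul_left (ε * w)).congr_fun fun s => ?_
    have : (s.factorial : ℝ) ≠ 0 := by exact_mod_cast s.factorial_ne_zero
    rw [Nat.factorial_succ]
    push_cast
    field_simp
    ring
  have h2 := (h0.mul_left b).add (h1.mul_left 2)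
  have e : b * Real.exp (ε * w) + 2 * (ε * w * Real.exp (ε * w)) =
      Real.exp (ε * w) * (b + 2 * (ε * w)) := by ring
  rw [e] at h2
  refine h2.congr_fun fun s => ?_
  rw [mul_pow]
  ring

/-- The parameter serves two ends: `ε = -1` is the trace itself, `ε = 1` the sum of absolute values.
-/
theorem hasSum_radialElement (m q : ℕ) (t : ℝ) {ε : ℝ} (hε : |ε| ≤ 1) :
    HasSum (fun s : ℕ => ε ^ s / s.factorial * radialElement m q s t)
      (∫ θ in (0 : ℝ)..1, Real.exp (ε * (t ^ 2 * (θ * (1 - θ)))) *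
        (((m + q : ℕ) : ℝ) + 1 + 2 * (t ^ 2 * (θ * (1 - θ))) + 2 * (ε * (t ^ 2 * (θ * (1 - θ))))) *
        (Real.exp (t ^ 2 * (θ * (1 - θ))) * ((1 - θ) ^ m * θ ^ q))) := by
  have hs : ∀ (δ θ : ℝ), HasSum (fun s : ℕ => δ ^ s / s.factorial *
      ((((m + q : ℕ) : ℝ) + 1 + 2 * s + 2 * (t ^ 2 * (θ * (1 - θ)))) *
        (t ^ 2 * (θ * (1 - θ))) ^ s * Real.exp (t ^ 2 * (θ * (1 - θ))) * ((1 - θ) ^ m * θ ^ q)))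
      (Real.exp (δ * (t ^ 2 * (θ * (1 - θ)))) *
        (((m + q : ℕ) : ℝ) + 1 + 2 * (t ^ 2 * (θ * (1 - θ))) + 2 * (δ * (t ^ 2 * (θ * (1 - θ))))) *
        (Real.exp (t ^ 2 * (θ * (1 - θ))) * ((1 - θ) ^ m * θ ^ q))) := by
    intro δ θ
    refine ((hasSum_exp_mul_affine δ (t ^ 2 * (θ * (1 - θ)))
      (((m + q : ℕ) : ℝ) + 1 + 2 * (t ^ 2 * (θ * (1 - θ))))).mul_right
      (Real.exp (t ^ 2 * (θ * (1 - θ))) * ((1 - θ) ^ m * θ ^ q))).congr_fun fun s => ?_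
    ring
  simp only [radialElement, ← intervalIntegral.integral_const_mul]
  -- On `[0, 1]` every factor other than the power of `ε` is nonnegative, so the `ε = 1` series
  -- dominates.
  refine intervalIntegral.hasSum_integral_of_dominated_convergence (μ := volume)
    (fun s θ => 1 ^ s / s.factorial *
      ((((m + q : ℕ) : ℝ) + 1 + 2 * s + 2 * (t ^ 2 * (θ * (1 - θ)))) *
        (t ^ 2 * (θ * (1 - θ))) ^ s * Real.exp (t ^ 2 * (θ * (1 - θ))) * ((1 - θ) ^ m * θ ^ q)))
    (fun s => Continuous.aestronglyMeasurable (by fun_prop))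
    (fun s => Filter.Eventually.of_forall fun θ hθ => ?_)
    (Filter.Eventually.of_forall fun θ _ => (hs 1 θ).summable) ?_
    (Filter.Eventually.of_forall fun θ _ => hs ε θ)
  · rw [Set.uIoc_of_le zero_le_one] at hθ
    have h1 : 0 ≤ θ := hθ.1.le
    have h2 : 0 ≤ 1 - θ := sub_nonneg.2 hθ.2
    rw [norm_mul, norm_div, norm_pow, Real.norm_eq_abs ε]
    refine mul_le_mul ?_ (le_of_eq (Real.norm_of_nonneg (by positivity))) (norm_nonneg _)
      (by positivity)
    rw [Real.norm_of_nonneg (Nat.cast_nonneg _)]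
    gcongr
  · rw [funext fun θ => (hs 1 θ).tsum_eq]
    exact Continuous.intervalIntegrable (by fun_prop) 0 1

theorem radialElement_nonneg (m q s : ℕ) (t : ℝ) : 0 ≤ radialElement m q s t := by
  refine intervalIntegral.integral_nonneg zero_le_one fun θ hθ => ?_
  have h1 : 0 ≤ θ := hθ.1
  have h2 : 0 ≤ 1 - θ := sub_nonneg.2 hθ.2
  positivity

/-- At `ε = -1` both the exponentials and the terms `±2w` cancel, so the dependence on `t`
disappears and `(m+q+1)` times the Beta integral remains. -/
theorem hasSum_alternating_radialElement (m q : ℕ) (t : ℝ) :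
    HasSum (fun s : ℕ => (-1) ^ s / s.factorial * radialElement m q s t)
      ((m + q).choose m : ℝ)⁻¹ := by
  have h := hasSum_radialElement m q t (ε := -1) (by simp)
  have h4 : ((m + q : ℕ) : ℝ) + 1 ≠ 0 := by positivity
  have e : ((m + q).choose m : ℝ)⁻¹ = ∫ θ in (0 : ℝ)..1,
      Real.exp (-1 * (t ^ 2 * (θ * (1 - θ)))) *
        (((m + q : ℕ) : ℝ) + 1 + 2 * (t ^ 2 * (θ * (1 - θ))) + 2 * (-1 * (t ^ 2 * (θ * (1 - θ))))) *
        (Real.exp (t ^ 2 * (θ * (1 - θ))) * ((1 - θ) ^ m * θ ^ q)) := by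
    have h5 := integral_one_sub_pow_mul_pow m q
    rw [eq_inv_mul_iff_mul_eq₀ h4, ← intervalIntegral.integral_const_mul] at h5
    rw [← h5]
    congr 1
    funext θ
    have h6 : Real.exp (-1 * (t ^ 2 * (θ * (1 - θ)))) * Real.exp (t ^ 2 * (θ * (1 - θ))) = 1 := by
      rw [← Real.exp_add]
      simp
    linear_combination (-(((m + q : ℕ) : ℝ) + 1) * ((1 - θ) ^ m * θ ^ q)) * h6
  rwa [e]

theorem summable_radialElement (m q : ℕ) (t : ℝ) :
    Summable (fun s : ℕ => radialElement m q s t / s.factorial) := by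
  refine (hasSum_radialElement m q t (ε := 1) (by simp)).summable.congr fun s => ?_
  rw [one_pow]
  ring

/-- Since `w ≤ t²/4`, one has `e^{2w} ≤ e^{t²/2}` and `N+1+4w ≤ (1+t²)(N+1)` with `N = m+q`. The
Beta integral is kept exact, so the bound retains the inverse binomial of the summability condition.
-/
theorem tsum_radialElement_le (m q : ℕ) (t : ℝ) :
    ∑' s : ℕ, radialElement m q s t / s.factorial ≤
      (1 + t ^ 2) * Real.exp (t ^ 2 / 2) * ((m + q).choose m : ℝ)⁻¹ := by
  have h := hasSum_radialElement m q t (ε := 1) (by simp)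
  have e : (fun s : ℕ => (1 : ℝ) ^ s / s.factorial * radialElement m q s t) =
      fun s : ℕ => radialElement m q s t / s.factorial := by
    funext s
    rw [one_pow]
    ring
  rw [e] at h
  have h4 : ((m + q : ℕ) : ℝ) + 1 ≠ 0 := by positivity
  have h5 := integral_one_sub_pow_mul_pow m q
  rw [eq_inv_mul_iff_mul_eq₀ h4] at h5
  rw [h.tsum_eq, ← h5, ← mul_assoc, ← intervalIntegral.integral_const_mul]
  refine intervalIntegral.integral_mono_on zero_le_one
    (Continuous.intervalIntegrable (by fun_prop) 0 1)
    (Continuous.intervalIntegrable (by fun_prop) 0 1) fun θ hθ => ?_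
  have h1 : 0 ≤ θ := hθ.1
  have h2 : 0 ≤ 1 - θ := sub_nonneg.2 hθ.2
  have hw0 : 0 ≤ t ^ 2 * (θ * (1 - θ)) := by positivity
  have hw : t ^ 2 * (θ * (1 - θ)) ≤ t ^ 2 / 4 := by
    have : θ * (1 - θ) ≤ 1 / 4 := by nlinarith [sq_nonneg (θ - 1 / 2)]
    nlinarith [sq_nonneg t]
  generalize t ^ 2 * (θ * (1 - θ)) = w at *
  have hN : (0 : ℝ) ≤ ((m + q : ℕ) : ℝ) := by positivity
  have h6 : Real.exp (1 * w) * Real.exp w ≤ Real.exp (t ^ 2 / 2) := by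
    rw [← Real.exp_add, Real.exp_le_exp]
    linarith
  have h7 : ((m + q : ℕ) : ℝ) + 1 + 2 * w + 2 * (1 * w) ≤
      (1 + t ^ 2) * (((m + q : ℕ) : ℝ) + 1) := by
    nlinarith [sq_nonneg t, mul_nonneg (sq_nonneg t) hN]
  have h8 : 0 ≤ (1 - θ) ^ m * θ ^ q := by positivity
  calc _ = (Real.exp (1 * w) * Real.exp w) * (((m + q : ℕ) : ℝ) + 1 + 2 * w + 2 * (1 * w)) *
        ((1 - θ) ^ m * θ ^ q) := by ring
    _ ≤ Real.exp (t ^ 2 / 2) * ((1 + t ^ 2) * (((m + q : ℕ) : ℝ) + 1)) *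
        ((1 - θ) ^ m * θ ^ q) := by gcongr
    _ = _ := by ring

/-- The `s`-th diagonal contribution to `Tr[G†(t,φ) a†ᵐ a^q]`. -/
noncomputable def diagonalTerm (φ t : ℝ) (m q s : ℕ) : ℂ :=
  Complex.exp (Complex.I * φ * ((q : ℂ) - m)) * (-Complex.I * t) ^ (m + q) *
    (((-1) ^ s / s.factorial * radialElement m q s t : ℝ) : ℂ)

/-- The square roots of factorials cancel, leaving `1/s!`, and the extra phase `(-i)^{2s}` is the
alternating sign. -/
theorem inner_opG_mul_monomialElement (φ t : ℝ) (m q s : ℕ) :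
    inner ℂ (opG t φ (fockKet (q + s))) (fockKet (m + s)) *
      monomialElement m q (m + s) (q + s) = diagonalTerm φ t m q s := by
  have h1 := sqrt_factorial_ne_zero (m + s)
  have h2 := sqrt_factorial_ne_zero (q + s)
  have h3 : (s.factorial : ℂ) ≠ 0 := by exact_mod_cast s.factorial_ne_zero
  have e1 : ((q + s : ℕ) : ℂ) - ((m + s : ℕ) : ℂ) = (q : ℂ) - m := by push_cast; ring
  have e2 : (-Complex.I) ^ (m + s + (q + s)) = (-Complex.I) ^ (m + q) * (-1) ^ s := by
    have : m + s + (q + s) = m + q + 2 * s := by ring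
    rw [this, pow_add, pow_mul, neg_sq, Complex.I_sq]
  rw [monomialElement_add, if_pos rfl, inner_opG_fockKet, integral_elementIntegrand, e1, e2,
    diagonalTerm, mul_pow]
  push_cast
  field_simp

theorem norm_diagonalTerm (φ t : ℝ) (m q s : ℕ) :
    ‖diagonalTerm φ t m q s‖ = |t| ^ (m + q) * (radialElement m q s t / s.factorial) := by
  rw [diagonalTerm, norm_mul, norm_mul, norm_exp_I_mul_sub, one_mul, norm_pow, norm_mul, norm_neg,
    Complex.norm_I, one_mul, Complex.norm_real, Complex.norm_real, Real.norm_eq_abs,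
    Real.norm_eq_abs, abs_mul, abs_div, abs_pow, abs_neg, abs_one, one_pow,
    abs_of_nonneg (radialElement_nonneg m q s t), Nat.abs_cast]
  ring

theorem hasSum_diagonalTerm (φ t : ℝ) (m q : ℕ) :
    HasSum (diagonalTerm φ t m q) (monomialCoeff m q φ t) := by
  have h := (Complex.hasSum_ofReal.2 (hasSum_alternating_radialElement m q t)).mul_left
    (Complex.exp (Complex.I * φ * ((q : ℂ) - m)) * (-Complex.I * t) ^ (m + q))
  rw [Complex.ofReal_inv, Complex.ofReal_natCast] at h
  rw [monomialCoeff, mul_right_comm]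
  exact h

theorem summable_norm_mul_diagonalTerm (φ t : ℝ) {c : ℕ → ℕ → ℂ}
    (hs : Summable (fun p : ℕ × ℕ => ‖c p.1 p.2‖ *
      (((p.1 + p.2).choose p.1 : ℝ)⁻¹ * Real.sqrt (p.1 + p.2).factorial))) :
    Summable (fun x : (ℕ × ℕ) × ℕ =>
      ‖c x.1.1 x.1.2 * diagonalTerm φ t x.1.1 x.1.2 x.2‖) := by
  have hsum : ∀ p : ℕ × ℕ, Summable fun s => ‖c p.1 p.2 * diagonalTerm φ t p.1 p.2 s‖ := by
    intro p
    simp_rw [norm_mul, norm_diagonalTerm]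
    exact ((summable_radialElement p.1 p.2 t).mul_left _).mul_left _
  refine (summable_prod_of_nonneg fun _ => norm_nonneg _).2 ⟨hsum, ?_⟩
  refine Summable.of_nonneg_of_le (fun p => tsum_nonneg fun s => norm_nonneg _) (fun p => ?_)
    (hs.mul_right ((1 + t ^ 2) * Real.exp (t ^ 2 / 2) * Real.exp (t ^ 2 / 2)))
  simp_rw [norm_mul, norm_diagonalTerm]
  rw [tsum_mul_left, tsum_mul_left]
  calc ‖c p.1 p.2‖ * (|t| ^ (p.1 + p.2) * ∑' s : ℕ, radialElement p.1 p.2 s t / s.factorial)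
      ≤ ‖c p.1 p.2‖ * ((Real.sqrt (p.1 + p.2).factorial * Real.exp (t ^ 2 / 2)) *
        ((1 + t ^ 2) * Real.exp (t ^ 2 / 2) * ((p.1 + p.2).choose p.1 : ℝ)⁻¹)) := by
        gcongr
        · exact tsum_nonneg fun s => div_nonneg (radialElement_nonneg _ _ _ _) (Nat.cast_nonneg _)
        · exact pow_le_sqrt_factorial_mul_exp t _
        · exact tsum_radialElement_le _ _ _
    _ = _ := by ring

theorem hasSum_traceTerm (X : Hilb →ₗ.[ℂ] Hilb) (hX : DefinedOnFock X) {c : ℕ → ℕ → ℂ}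
    (hc : HasNormalOrderedForm X hX c)
    (hs : Summable (fun p : ℕ × ℕ => ‖c p.1 p.2‖ *
      (((p.1 + p.2).choose p.1 : ℝ)⁻¹ * Real.sqrt (p.1 + p.2).factorial))) (φ t : ℝ) :
    HasSum (traceTerm (opG t φ) X hX)
      (∑' p : ℕ × ℕ, c p.1 p.2 * monomialCoeff p.1 p.2 φ t) := by
  have hD := (summable_norm_mul_diagonalTerm φ t hs).of_norm
  have h1 : HasSum (fun x : (ℕ × ℕ) × ℕ => c x.1.1 x.1.2 * diagonalTerm φ t x.1.1 x.1.2 x.2)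
      (∑' p : ℕ × ℕ, c p.1 p.2 * monomialCoeff p.1 p.2 φ t) := by
    have h := hD.hasSum.prod_fiberwise fun p => (hasSum_diagonalTerm φ t p.1 p.2).mul_left
      (c p.1 p.2)
    rw [h.tsum_eq]
    exact hD.hasSum
  -- The full family over `n`, `k` and `(m, q)`. It is supported on `n = q+s`, `k = m+s`, so its
  -- absolute summability is that of the diagonal terms and it may be summed in either order.
  set Φ : ℕ × (ℕ × (ℕ × ℕ)) → ℂ := fun y =>
    inner ℂ (opG t φ (fockKet y.1)) (fockKet y.2.1) *
      (c y.2.2.1 y.2.2.2 * monomialElement y.2.2.1 y.2.2.2 y.2.1 y.1) with hΦ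
  have hinj : Function.Injective (fun x : (ℕ × ℕ) × ℕ =>
      ((x.1.2 + x.2, (x.1.1 + x.2, x.1)) : ℕ × (ℕ × (ℕ × ℕ)))) := by
    rintro ⟨⟨m, q⟩, s⟩ ⟨⟨m', q'⟩, s'⟩ h
    simp only [Prod.mk.injEq] at h ⊢
    omega
  have h2 : HasSum Φ (∑' p : ℕ × ℕ, c p.1 p.2 * monomialCoeff p.1 p.2 φ t) := by
    refine (hinj.hasSum_iff ?_).1 (h1.congr_fun ?_)
    · rintro ⟨n, k, m, q⟩ hy
      have h0 : monomialElement m q k n = 0 := monomialElement_eq_zero fun s hs' => by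
        refine hy ⟨((m, q), s), ?_⟩
        simp only [hs'.1, hs'.2]
      simp only [hΦ, h0, mul_zero]
    · rintro ⟨⟨m, q⟩, s⟩
      simp only [hΦ, Function.comp_apply, ← inner_opG_mul_monomialElement]
      ring
  refine h2.prod_fiberwise fun n => ?_
  -- For fixed `n`, the sum over `(m, q)` gives `⟨k|X|n⟩`, and the sum over `k` is Parseval's
  -- formula on the span of the number states.
  have h3 := h2.summable.prod_factor n
  have h4 := h3.hasSum.prod_fiberwise fun k =>
    (hc k n).mul_left (inner ℂ (opG t φ (fockKet n)) (fockKet k))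
  have h5 := hasSum_inner_fockKet (opG t φ (fockKet n)) (X ⟨fockKet n, hX n⟩)
    fun e he => inner_opG_eq_zero φ t he (fockKet n)
  have h6 : traceTerm (opG t φ) X hX n = ∑' x, Φ (n, x) := by
    rw [h4.unique h5, traceTerm, ContinuousLinearMap.adjoint_inner_right]
  rw [h6]
  exact h3.hasSum

/-! ### Monomials as operators with a single coefficient -/

theorem inner_normalMonomial (m q k l : ℕ) :
    inner ℂ (fockKet k) (normalMonomial m q ⟨fockKet l, definedOnFock_normalMonomial m q l⟩) =
      monomialElement m q k l := by
  have h : (LinearEquiv.ofInjective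
      (SchwartzMap.toLpCLM ℂ ℂ 2 (volume : Measure ℝ) : 𝓢(ℝ, ℂ) →L[ℂ] Hilb).toLinearMap
      ket_injective).symm ⟨fockKet l, definedOnFock_normalMonomial m q l⟩ = fock l := by
    rw [LinearEquiv.symm_apply_eq]
    rfl
  have h2 : normalMonomial m q ⟨fockKet l, definedOnFock_normalMonomial m q l⟩ =
      ket (((creation ^ m) * (annihilation ^ q)) ((LinearEquiv.ofInjective
      (SchwartzMap.toLpCLM ℂ ℂ 2 (volume : Measure ℝ) : 𝓢(ℝ, ℂ) →L[ℂ] Hilb).toLinearMap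
      ket_injective).symm ⟨fockKet l, definedOnFock_normalMonomial m q l⟩)) := rfl
  rw [h2, h]
  rfl

theorem hasNormalOrderedForm_normalMonomial (m q : ℕ) :
    HasNormalOrderedForm (normalMonomial m q) (definedOnFock_normalMonomial m q)
      (fun m' q' => if (m', q') = (m, q) then 1 else 0) := by
  intro k l
  rw [inner_normalMonomial]
  have h := hasSum_single (m, q) (f := fun p : ℕ × ℕ =>
    (if p = (m, q) then (1 : ℂ) else 0) * monomialElement p.1 p.2 k l) fun p hp => by
      rw [if_neg hp, zero_mul]
  rw [if_pos rfl, one_mul] at h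
  exact h

theorem summable_single_coeff (m q : ℕ) :
    Summable (fun p : ℕ × ℕ => ‖(if (p.1, p.2) = (m, q) then (1 : ℂ) else 0)‖ *
      (((p.1 + p.2).choose p.1 : ℝ)⁻¹ * Real.sqrt (p.1 + p.2).factorial)) := by
  refine summable_of_ne_finset_zero (s := {(m, q)}) fun p hp => ?_
  have : (p.1, p.2) ≠ (m, q) := by simpa using hp
  rw [if_neg this, norm_zero, zero_mul]

theorem tsum_single_coeff (m q : ℕ) (φ t : ℝ) :
    ∑' p : ℕ × ℕ, (if (p.1, p.2) = (m, q) then (1 : ℂ) else 0) * monomialCoeff p.1 p.2 φ t =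
      monomialCoeff m q φ t := by
  rw [tsum_eq_single (m, q)]
  · simp
  · intro p hp
    rw [if_neg (by simpa using hp), zero_mul]

/-! ### Termwise integration against the Gaussian kernel -/

theorem integrable_of_hasSum_of_summable_integral_norm {ι α E : Type*} [Countable ι]
    [MeasurableSpace α] {μ : Measure α} [NormedAddCommGroup E] {F : ι → α → E} {f : α → E}
    (hF : ∀ i, Integrable (F i) μ) (hs : Summable fun i => ∫ a, ‖F i a‖ ∂μ)
    (hf : ∀ᵐ a ∂μ, HasSum (fun i => F i a) (f a)) : Integrable f μ := by
  refine ⟨aestronglyMeasurable_of_tendsto_ae Filter.atTop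
    (f := fun (s : Finset ι) a => ∑ i ∈ s, F i a)
    (fun s => Finset.aestronglyMeasurable_fun_sum s fun i _ => (hF i).1) hf, ?_⟩
  have h1 : ∫⁻ a, ‖f a‖ₑ ∂μ ≤ ∫⁻ a, ∑' i, ‖F i a‖ₑ ∂μ := by
    refine lintegral_mono_ae ?_
    filter_upwards [hf] with a ha
    rw [← ha.tsum_eq]
    exact enorm_tsum_le_tsum_enorm
  refine lt_of_le_of_lt h1 ?_
  rw [lintegral_tsum fun i => (hF i).1.enorm]
  have h2 : ∀ i, ∫⁻ a, ‖F i a‖ₑ ∂μ = ENNReal.ofReal (∫ a, ‖F i a‖ ∂μ) := fun i =>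
    (ofReal_integral_norm_eq_lintegral_enorm (hF i)).symm
  simp_rw [h2]
  rw [← ENNReal.ofReal_tsum_of_nonneg (fun i => integral_nonneg fun _ => norm_nonneg _) hs]
  exact ENNReal.ofReal_lt_top

/-- The series `∑ a_{mq} (-it)^{m+q}`. -/
noncomputable def phaseSeries (a : ℕ × ℕ → ℂ) (t : ℝ) : ℂ :=
  ∑' p : ℕ × ℕ, a p * (-Complex.I * t) ^ (p.1 + p.2)

theorem hasSum_phaseSeries {a : ℕ × ℕ → ℂ}
    (ha : Summable fun p : ℕ × ℕ => ‖a p‖ * Real.sqrt (p.1 + p.2).factorial) (t : ℝ) :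
    HasSum (fun p : ℕ × ℕ => a p * (-Complex.I * t) ^ (p.1 + p.2)) (phaseSeries a t) := by
  refine (Summable.of_norm_bounded (ha.mul_right (Real.exp (t ^ 2 / 2))) fun p => ?_).hasSum
  rw [norm_mul, norm_pow, norm_mul, norm_neg, Complex.norm_I, one_mul, Complex.norm_real,
    Real.norm_eq_abs, mul_assoc]
  exact mul_le_mul_of_nonneg_left (pow_le_sqrt_factorial_mul_exp t _) (norm_nonneg _)

theorem phaseSeries_term_mul_gaussKernel (a : ℕ × ℕ → ℂ) (p : ℕ × ℕ) (t x : ℝ) :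
    a p * (-Complex.I * t) ^ (p.1 + p.2) * gaussKernel t x =
      (a p * (-Complex.I) ^ (p.1 + p.2)) * ((t : ℂ) ^ (p.1 + p.2) * gaussKernel t x) := by
  rw [mul_pow]
  ring

theorem integrable_phaseSeries_term (a : ℕ × ℕ → ℂ) (p : ℕ × ℕ) (x : ℝ) :
    Integrable (fun t : ℝ => a p * (-Complex.I * t) ^ (p.1 + p.2) * gaussKernel t x) := by
  simp_rw [phaseSeries_term_mul_gaussKernel]
  exact (integrable_pow_mul_gaussKernel _ x).const_mul _

theorem summable_integral_norm_phaseSeries_term {a : ℕ × ℕ → ℂ}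
    (ha : Summable fun p : ℕ × ℕ => ‖a p‖ * Real.sqrt (p.1 + p.2).factorial) (x : ℝ) :
    Summable fun p : ℕ × ℕ =>
      ∫ t : ℝ, ‖a p * (-Complex.I * t) ^ (p.1 + p.2) * gaussKernel t x‖ := by
  refine Summable.of_nonneg_of_le (fun p => integral_nonneg fun _ => norm_nonneg _) (fun p => ?_)
    (ha.mul_right (3 * Real.exp (2 * x ^ 2)))
  simp_rw [phaseSeries_term_mul_gaussKernel, norm_mul (a p * _)]
  rw [integral_const_mul, norm_mul, norm_pow, norm_neg, Complex.norm_I, one_pow, mul_one,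
    mul_assoc]
  refine mul_le_mul_of_nonneg_left ?_ (norm_nonneg _)
  refine (integral_norm_pow_mul_gaussKernel_le (p.1 + p.2) x).trans (le_of_eq ?_)
  ring

theorem integrable_phaseSeries_mul_gaussKernel {a : ℕ × ℕ → ℂ}
    (ha : Summable fun p : ℕ × ℕ => ‖a p‖ * Real.sqrt (p.1 + p.2).factorial) (x : ℝ) :
    Integrable (fun t : ℝ => phaseSeries a t * gaussKernel t x) :=
  integrable_of_hasSum_of_summable_integral_norm (fun p => integrable_phaseSeries_term a p x)
    (summable_integral_norm_phaseSeries_term ha x)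
    (Filter.Eventually.of_forall fun t => (hasSum_phaseSeries ha t).mul_right _)

/-- The bound `3√n!` on absolute moments permits termwise integration, and each term is a Hermite
moment. -/
theorem hasSum_kernelTransform {a : ℕ × ℕ → ℂ}
    (ha : Summable fun p : ℕ × ℕ => ‖a p‖ * Real.sqrt (p.1 + p.2).factorial) (x : ℝ) :
    HasSum (fun p : ℕ × ℕ => a p * (hermiteFn (p.1 + p.2) (2 * x) : ℂ))
      (kernelTransform (phaseSeries a) x) := by
  have h := hasSum_integral_of_summable_integral_norm
    (fun p => integrable_phaseSeries_term a p x) (summable_integral_norm_phaseSeries_term ha x)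
  have e : ∫ t : ℝ, ∑' p : ℕ × ℕ, a p * (-Complex.I * t) ^ (p.1 + p.2) * gaussKernel t x =
      kernelTransform (phaseSeries a) x := by
    rw [kernelTransform]
    congr 1
    funext t
    exact ((hasSum_phaseSeries ha t).mul_right _).tsum_eq
  rw [e] at h
  refine h.congr_fun fun p => ?_
  rw [← integral_pow_mul_gaussKernel, ← integral_const_mul]
  simp_rw [mul_assoc]

/-! ### Bochner integrals on vectors with bounded spectral support -/

theorem continuous_spectralVar (φ : ℝ) : Continuous (spectralVar φ) := by
  unfold spectralVar
  split_ifs <;> fun_prop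

theorem kernelTransform_eq (C : ℝ → ℂ) (x : ℝ) : kernelTransform C x =
    Complex.exp (2 * (x : ℂ) ^ 2) *
      ∫ t : ℝ, C t * gaussKernel t 0 * Complex.exp (((2 * t * x : ℝ) : ℂ) * Complex.I) := by
  rw [kernelTransform, ← integral_const_mul]
  congr 1
  funext t
  rw [gaussKernel_zero_right_mul t x]
  ring

/-- Integrability at `x = 0` suffices: up to the factor `e^{2x²}`, the variable `x` enters only
through a phase. -/
theorem continuous_kernelTransform {C : ℝ → ℂ}
    (hC : Integrable fun t : ℝ => C t * gaussKernel t 0) : Continuous (kernelTransform C) := by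
  rw [funext (kernelTransform_eq C)]
  refine Continuous.mul (by fun_prop) ?_
  refine continuous_of_dominated (bound := fun t => ‖C t * gaussKernel t 0‖) (fun x => ?_)
    (fun x => Filter.Eventually.of_forall fun t => ?_) hC.norm
    (Filter.Eventually.of_forall fun t => by fun_prop)
  · exact hC.1.mul (Continuous.aestronglyMeasurable (by fun_prop))
  · rw [norm_mul, Complex.norm_exp_ofReal_mul_I, mul_one]

theorem mem_funcCalc_domain {φ R : ℝ} {v : Hilb} (hv : SpectrallyBounded φ R v) {g : ℝ → ℂ}
    (hg : Continuous g) : v ∈ (funcCalc φ g).domain := by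
  obtain ⟨M, hM⟩ := isCompact_Icc.exists_bound_of_continuousOn (s := Set.Icc (-R) R)
    hg.continuousOn
  refine (Lp.memLp (spectralRep φ v)).of_le_mul (c := M) ?_ ?_
  · exact (hg.comp (continuous_spectralVar φ)).aestronglyMeasurable.mul (Lp.aestronglyMeasurable _)
  · filter_upwards [hv] with ξ h
    rcases lt_or_ge R |spectralVar φ ξ| with hR | hR
    · simp [h hR]
    · rw [norm_mul]
      exact mul_le_mul_of_nonneg_right (hM _ (abs_le.1 hR)) (norm_nonneg _)

theorem spectralRep_funcCalc {φ : ℝ} {g : ℝ → ℂ} {v : Hilb} (hv : v ∈ (funcCalc φ g).domain) :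
    spectralRep φ (funcCalc φ g ⟨v, hv⟩) =ᵐ[volume]
      fun ξ => g (spectralVar φ ξ) * spectralRep φ v ξ := by
  have h : spectralRep φ (funcCalc φ g ⟨v, hv⟩) = MemLp.toLp _ hv :=
    (spectralRep φ).apply_symm_apply _
  rw [h]
  exact MemLp.coeFn_toLp hv

theorem norm_funcCalc_sub_le {φ R M : ℝ} {v : Hilb} (hv : SpectrallyBounded φ R v) {g h : ℝ → ℂ}
    (hg : v ∈ (funcCalc φ g).domain) (hh : v ∈ (funcCalc φ h).domain)
    (hM : ∀ x, |x| ≤ R → ‖g x - h x‖ ≤ M) :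
    ‖funcCalc φ g ⟨v, hg⟩ - funcCalc φ h ⟨v, hh⟩‖ ≤ M * ‖v‖ := by
  rw [← (spectralRep φ).norm_map, ← (spectralRep φ).norm_map v, map_sub]
  refine Lp.norm_le_mul_norm_of_ae_le_mul ?_
  filter_upwards [hv, spectralRep_funcCalc hg, spectralRep_funcCalc hh,
    Lp.coeFn_sub (spectralRep φ (funcCalc φ g ⟨v, hg⟩)) (spectralRep φ (funcCalc φ h ⟨v, hh⟩))]
    with ξ h0 h1 h2 h3
  rw [h3, Pi.sub_apply, h1, h2, ← sub_mul, norm_mul]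
  rcases lt_or_ge R |spectralVar φ ξ| with hR | hR
  · simp [h0 hR]
  · exact mul_le_mul_of_nonneg_right (hM _ hR) (norm_nonneg _)

/-- The function `e^{2x²} e^{2itx}`, to which the kernel is proportional. -/
noncomputable def modulatedGauss (t x : ℝ) : ℂ :=
  Complex.exp (2 * (x : ℂ) ^ 2) * Complex.exp (((2 * t * x : ℝ) : ℂ) * Complex.I)

theorem norm_cexp_two_mul_sq_le {R x : ℝ} (hx : |x| ≤ R) :
    ‖Complex.exp (2 * (x : ℂ) ^ 2)‖ ≤ Real.exp (2 * R ^ 2) := by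
  have e : (2 : ℂ) * (x : ℂ) ^ 2 = ((2 * x ^ 2 : ℝ) : ℂ) := by push_cast; rfl
  rw [e, Complex.norm_exp_ofReal, Real.exp_le_exp, ← sq_abs x]
  gcongr

theorem continuous_modulatedGauss (t : ℝ) : Continuous (modulatedGauss t) := by
  unfold modulatedGauss
  fun_prop

theorem norm_modulatedGauss_sub_le {R x : ℝ} (hx : |x| ≤ R) (t s : ℝ) :
    ‖modulatedGauss t x - modulatedGauss s x‖ ≤ Real.exp (2 * R ^ 2) * (2 * R * |t - s|) := by
  have e : Complex.exp (((2 * t * x : ℝ) : ℂ) * Complex.I) =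
      Complex.exp (((2 * s * x : ℝ) : ℂ) * Complex.I) *
        Complex.exp (Complex.I * ((2 * (t - s) * x : ℝ) : ℂ)) := by
    rw [← Complex.exp_add]
    congr 1
    push_cast
    ring
  rw [modulatedGauss, modulatedGauss, ← mul_sub, norm_mul, e, ← mul_sub_one, norm_mul,
    Complex.norm_exp_ofReal_mul_I, one_mul]
  refine mul_le_mul (norm_cexp_two_mul_sq_le hx) ?_ (norm_nonneg _) (Real.exp_pos _).le
  refine (Real.norm_exp_I_mul_ofReal_sub_one_le).trans ?_
  rw [Real.norm_eq_abs, abs_mul, abs_mul, abs_two]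
  nlinarith [abs_nonneg (t - s)]

/-- For `|x| ≤ R` the phase `e^{2itx}` is Lipschitz in `t`, uniformly in `x`. Norm continuity
provides the strong measurability needed for the Bochner integral. -/
theorem continuous_funcCalc_modulatedGauss {φ R : ℝ} {v : Hilb} (hv : SpectrallyBounded φ R v) :
    Continuous fun t : ℝ => funcCalc φ (modulatedGauss t)
      ⟨v, mem_funcCalc_domain hv (continuous_modulatedGauss t)⟩ := by
  have h : LipschitzWith (Real.toNNReal (Real.exp (2 * R ^ 2) * (2 * R) * ‖v‖))
      fun t : ℝ => funcCalc φ (modulatedGauss t)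
        ⟨v, mem_funcCalc_domain hv (continuous_modulatedGauss t)⟩ := by
    refine LipschitzWith.of_dist_le_mul fun t s => ?_
    rw [dist_eq_norm, Real.dist_eq]
    refine (norm_funcCalc_sub_le hv _ _ fun x hx => norm_modulatedGauss_sub_le hx t s).trans ?_
    rw [show Real.exp (2 * R ^ 2) * (2 * R * |t - s|) * ‖v‖ =
      Real.exp (2 * R ^ 2) * (2 * R) * ‖v‖ * |t - s| by ring]
    -- No sign of `R` is assumed; `Real.toNNReal` only enlarges the constant.
    exact mul_le_mul_of_nonneg_right (Real.le_coe_toNNReal _) (abs_nonneg _)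
  exact h.continuous

theorem norm_funcCalc_modulatedGauss_le {φ R : ℝ} {v : Hilb} (hv : SpectrallyBounded φ R v)
    (t : ℝ) : ‖funcCalc φ (modulatedGauss t)
      ⟨v, mem_funcCalc_domain hv (continuous_modulatedGauss t)⟩‖ ≤
        Real.exp (2 * R ^ 2) * ‖v‖ := by
  rw [← (spectralRep φ).norm_map, ← (spectralRep φ).norm_map v]
  refine Lp.norm_le_mul_norm_of_ae_le_mul ?_
  filter_upwards [hv, spectralRep_funcCalc
    (mem_funcCalc_domain hv (continuous_modulatedGauss t))] with ξ h0 h1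
  rw [h1, norm_mul]
  rcases lt_or_ge R |spectralVar φ ξ| with hR | hR
  · simp [h0 hR]
  · refine mul_le_mul_of_nonneg_right ?_ (norm_nonneg _)
    rw [modulatedGauss, norm_mul, Complex.norm_exp_ofReal_mul_I, mul_one]
    exact norm_cexp_two_mul_sq_le hR

theorem continuous_gaussKernel_right (t : ℝ) : Continuous (gaussKernel t) := by
  unfold gaussKernel
  fun_prop

theorem opF_eq_smul {φ R : ℝ} {v : Hilb} (hv : SpectrallyBounded φ R v) (t : ℝ)
    (h : v ∈ (opF t φ).domain) : opF t φ ⟨v, h⟩ = gaussKernel t 0 •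
      funcCalc φ (modulatedGauss t)
        ⟨v, mem_funcCalc_domain hv (continuous_modulatedGauss t)⟩ := by
  apply (spectralRep φ).injective
  rw [map_smul]
  apply Lp.ext
  filter_upwards [spectralRep_funcCalc (g := gaussKernel t) h, spectralRep_funcCalc
    (mem_funcCalc_domain hv (continuous_modulatedGauss t)),
    Lp.coeFn_smul (gaussKernel t 0) (spectralRep φ (funcCalc φ (modulatedGauss t)
      ⟨v, mem_funcCalc_domain hv (continuous_modulatedGauss t)⟩))] with ξ h1 h2 h3
  rw [h3, Pi.smul_apply, h2, smul_eq_mul]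
  refine h1.trans ?_
  rw [gaussKernel_zero_right_mul, modulatedGauss, mul_assoc (gaussKernel t 0)]

theorem inner_funcCalc {φ : ℝ} {g : ℝ → ℂ} {v : Hilb} (hv : v ∈ (funcCalc φ g).domain) (u : Hilb) :
    inner ℂ u (funcCalc φ g ⟨v, hv⟩) = ∫ ξ, (starRingEnd ℂ) (spectralRep φ u ξ) *
      (g (spectralVar φ ξ) * spectralRep φ v ξ) := by
  rw [← (spectralRep φ).inner_map_map, L2.inner_def]
  refine integral_congr_ae ?_
  filter_upwards [spectralRep_funcCalc hv] with ξ h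
  rw [h, RCLike.inner_apply, mul_comm]

/-- The vectors have norm bounded in `t`, so the scalar weight alone gives integrability. Equality
is tested against every `u`, where it becomes Fubini's theorem in `(t, ξ)`. -/
theorem integral_smul_funcCalc_modulatedGauss {φ R : ℝ} {v : Hilb}
    (hv : SpectrallyBounded φ R v) {C : ℝ → ℂ}
    (hC : Integrable fun t : ℝ => C t * gaussKernel t 0) :
    Integrable (fun t : ℝ => (C t * gaussKernel t 0) • funcCalc φ (modulatedGauss t)
      ⟨v, mem_funcCalc_domain hv (continuous_modulatedGauss t)⟩) ∧
    ∫ t : ℝ, (C t * gaussKernel t 0) • funcCalc φ (modulatedGauss t)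
      ⟨v, mem_funcCalc_domain hv (continuous_modulatedGauss t)⟩ =
    funcCalc φ (kernelTransform C)
      ⟨v, mem_funcCalc_domain hv (continuous_kernelTransform hC)⟩ := by
  have hi : Integrable (fun t : ℝ => (C t * gaussKernel t 0) • funcCalc φ (modulatedGauss t)
      ⟨v, mem_funcCalc_domain hv (continuous_modulatedGauss t)⟩) := by
    refine (hC.norm.mul_const (Real.exp (2 * R ^ 2) * ‖v‖)).mono'
      (hC.1.smul (continuous_funcCalc_modulatedGauss hv).aestronglyMeasurable)
      (Filter.Eventually.of_forall fun t => ?_)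
    rw [norm_smul]
    exact mul_le_mul_of_nonneg_left (norm_funcCalc_modulatedGauss_le hv t) (norm_nonneg _)
  refine ⟨hi, ext_inner_left ℂ fun u => ?_⟩
  rw [← integral_inner hi, inner_funcCalc]
  simp_rw [inner_smul_right, inner_funcCalc, ← integral_const_mul]
  have hE : MemLp (fun ξ : ℝ => Complex.exp (2 * (spectralVar φ ξ : ℂ) ^ 2) *
      spectralRep φ v ξ) 2 volume :=
    mem_funcCalc_domain hv (g := fun x : ℝ => Complex.exp (2 * (x : ℂ) ^ 2)) (by fun_prop)
  have hm : Integrable (fun ξ : ℝ => (starRingEnd ℂ) (spectralRep φ u ξ) *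
      (Complex.exp (2 * (spectralVar φ ξ : ℂ) ^ 2) * spectralRep φ v ξ)) :=
    ((Lp.memLp (spectralRep φ u)).star).integrable_mul hE
  -- The integrand on the product is a function of `t` times a function of `ξ`, up to a phase of
  -- modulus one.
  have hK : Integrable (fun z : ℝ × ℝ => (C z.1 * gaussKernel z.1 0 *
      ((starRingEnd ℂ) (spectralRep φ u z.2) *
      (Complex.exp (2 * (spectralVar φ z.2 : ℂ) ^ 2) * spectralRep φ v z.2))) *
      Complex.exp (((2 * z.1 * spectralVar φ z.2 : ℝ) : ℂ) * Complex.I))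
      (volume.prod volume) := by
    refine (hC.mul_prod hm).mul_bdd (c := 1) ?_ (Filter.Eventually.of_forall fun z => ?_)
    · have := continuous_spectralVar φ
      exact Continuous.aestronglyMeasurable (by fun_prop)
    · rw [Complex.norm_exp_ofReal_mul_I]
  have hK' : Integrable (Function.uncurry fun t ξ : ℝ => C t * gaussKernel t 0 *
      ((starRingEnd ℂ) (spectralRep φ u ξ) *
        (modulatedGauss t (spectralVar φ ξ) * spectralRep φ v ξ))) (volume.prod volume) := by
    refine hK.congr (Filter.Eventually.of_forall fun z => ?_)
    simp only [Function.uncurry, modulatedGauss]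
    ring
  rw [integral_integral_swap hK']
  congr 1
  funext ξ
  rw [kernelTransform_eq, mul_comm (Complex.exp _), mul_assoc, mul_left_comm,
    ← integral_mul_const]
  congr 1
  funext t
  rw [modulatedGauss]
  ring

theorem exists_integral_opF {φ R : ℝ} {v : Hilb} (hv : SpectrallyBounded φ R v) {C : ℝ → ℂ}
    (hC : Integrable fun t : ℝ => C t * gaussKernel t 0) :
    ∃ (hF : ∀ t : ℝ, v ∈ (opF t φ).domain) (hf : v ∈ (funcCalc φ (kernelTransform C)).domain),
      Integrable (fun t : ℝ => C t • (opF t φ) ⟨v, hF t⟩) volume ∧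
      ∫ t : ℝ, C t • (opF t φ) ⟨v, hF t⟩ = (funcCalc φ (kernelTransform C)) ⟨v, hf⟩ := by
  have e : ∀ (t : ℝ) (h : v ∈ (opF t φ).domain), (C t * gaussKernel t 0) •
      funcCalc φ (modulatedGauss t)
        ⟨v, mem_funcCalc_domain hv (continuous_modulatedGauss t)⟩ = C t • opF t φ ⟨v, h⟩ := by
    intro t h
    rw [opF_eq_smul hv t h, smul_smul]
  have h := integral_smul_funcCalc_modulatedGauss hv hC
  exact ⟨fun t => mem_funcCalc_domain hv (continuous_gaussKernel_right t),
    mem_funcCalc_domain hv (continuous_kernelTransform hC),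
    h.1.congr (Filter.Eventually.of_forall fun t => e t _),
    (integral_congr_ae (Filter.Eventually.of_forall fun t => (e t _).symm)).trans h.2⟩

/-! ### Matrix elements and the average over the angle -/

theorem kernelTransform_mul_term (a : ℕ × ℕ → ℂ) (φ : ℝ) (k l : ℕ) (p : ℕ × ℕ) (ξ : ℝ) :
    (starRingEnd ℂ) (spectralRep φ (fockKet k) ξ) *
      (a p * (hermiteFn (p.1 + p.2) (2 * spectralVar φ ξ) : ℂ) * spectralRep φ (fockKet l) ξ) =
      a p * hermiteIntegrand φ (p.1 + p.2) k l ξ := by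
  rw [hermiteIntegrand]
  ring

theorem spectralForm_phaseSeries {a : ℕ × ℕ → ℂ}
    (ha : Summable fun p : ℕ × ℕ => ‖a p‖ * Real.sqrt (p.1 + p.2).factorial) (φ : ℝ) (k l : ℕ) :
    SpectralFormConverges φ (kernelTransform (phaseSeries a)) (fockKet k) (fockKet l) ∧
    HasSum (fun p : ℕ × ℕ => a p * ∫ ξ, hermiteIntegrand φ (p.1 + p.2) k l ξ)
      (spectralForm φ (kernelTransform (phaseSeries a)) (fockKet k) (fockKet l)) := by
  have h1 : ∀ p : ℕ × ℕ, Integrable fun ξ => a p * hermiteIntegrand φ (p.1 + p.2) k l ξ :=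
    fun p => (integrable_hermiteIntegrand φ _ k l).const_mul _
  have h2 : Summable fun p : ℕ × ℕ => ∫ ξ, ‖a p * hermiteIntegrand φ (p.1 + p.2) k l ξ‖ := by
    refine Summable.of_nonneg_of_le (fun p => integral_nonneg fun _ => norm_nonneg _)
      (fun p => ?_) (ha.mul_right (wickBound k l))
    simp_rw [norm_mul]
    rw [integral_const_mul, mul_assoc]
    exact mul_le_mul_of_nonneg_left (integral_norm_hermiteIntegrand_le φ _ k l) (norm_nonneg _)
  have h3 : ∀ ξ : ℝ, HasSum (fun p : ℕ × ℕ => a p * hermiteIntegrand φ (p.1 + p.2) k l ξ)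
      ((starRingEnd ℂ) (spectralRep φ (fockKet k) ξ) *
        (kernelTransform (phaseSeries a) (spectralVar φ ξ) * spectralRep φ (fockKet l) ξ)) := by
    intro ξ
    simp_rw [← kernelTransform_mul_term]
    exact ((hasSum_kernelTransform ha (spectralVar φ ξ)).mul_right _).mul_left _
  refine ⟨integrable_of_hasSum_of_summable_integral_norm h1 h2 (Filter.Eventually.of_forall h3), ?_⟩
  have h4 := hasSum_integral_of_summable_integral_norm h1 h2
  rw [funext fun ξ => (h3 ξ).tsum_eq] at h4
  simp only [integral_const_mul] at h4
  exact h4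

/-- The coefficients of the power series of `Tr[G†(t,φ) X]` in `-it`. -/
noncomputable def traceCoeff (c : ℕ → ℕ → ℂ) (φ : ℝ) (p : ℕ × ℕ) : ℂ :=
  c p.1 p.2 * (Complex.exp (Complex.I * φ * ((p.2 : ℂ) - p.1)) * ((p.1 + p.2).choose p.1 : ℂ)⁻¹)

theorem norm_traceCoeff (c : ℕ → ℕ → ℂ) (φ : ℝ) (p : ℕ × ℕ) :
    ‖traceCoeff c φ p‖ = ‖c p.1 p.2‖ * ((p.1 + p.2).choose p.1 : ℝ)⁻¹ := by
  rw [traceCoeff, norm_mul, norm_mul, norm_exp_I_mul_sub, one_mul, norm_inv, Complex.norm_natCast]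

theorem tsum_mul_monomialCoeff (c : ℕ → ℕ → ℂ) (φ t : ℝ) :
    ∑' p : ℕ × ℕ, c p.1 p.2 * monomialCoeff p.1 p.2 φ t = phaseSeries (traceCoeff c φ) t := by
  rw [phaseSeries]
  congr 1
  funext p
  rw [traceCoeff, monomialCoeff, mul_assoc (c p.1 p.2)]

theorem summable_traceCoeff {c : ℕ → ℕ → ℂ}
    (hs : Summable (fun p : ℕ × ℕ => ‖c p.1 p.2‖ *
      (((p.1 + p.2).choose p.1 : ℝ)⁻¹ * Real.sqrt (p.1 + p.2).factorial))) (φ : ℝ) :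
    Summable fun p : ℕ × ℕ => ‖traceCoeff c φ p‖ * Real.sqrt (p.1 + p.2).factorial := by
  simpa only [norm_traceCoeff, mul_assoc] using hs

theorem integral_exp_two_mul_int (n : ℤ) :
    ∫ φ in (0 : ℝ)..Real.pi, Complex.exp (2 * n * Complex.I * φ) =
      if n = 0 then (Real.pi : ℂ) else 0 := by
  split_ifs with h
  · simp [h]
  · have hc : (2 * n * Complex.I : ℂ) ≠ 0 := by simp [h]
    have h1 : Complex.exp (2 * n * Complex.I * Real.pi) = 1 := by
      rw [Complex.exp_eq_one_iff]
      exact ⟨n, by ring⟩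
    rw [integral_exp_mul_complex hc, h1]
    simp

/-- Since `r.1 + r.2 = p.1 + p.2`, the total phase is `e^{2iφ(r.1-p.1)}`. Its exponent is an even
multiple of `iφ`, so half a turn already gives orthogonality and only `r = p` survives. -/
theorem integral_traceCoeff_mul (c : ℕ → ℕ → ℂ) (p : ℕ × ℕ) (k l : ℕ) :
    ∫ φ in (0 : ℝ)..Real.pi, traceCoeff c φ p *
      ∫ ξ, hermiteIntegrand φ (p.1 + p.2) k l ξ =
      Real.pi * (c p.1 p.2 * monomialElement p.1 p.2 k l) := by
  have e : ∀ φ : ℝ, traceCoeff c φ p * ∫ ξ, hermiteIntegrand φ (p.1 + p.2) k l ξ =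
      ∑ r ∈ Finset.HasAntidiagonal.antidiagonal (p.1 + p.2),
        (c p.1 p.2 * ((p.1 + p.2).choose p.1 : ℂ)⁻¹ * ((p.1 + p.2).choose r.1 : ℂ) *
          monomialElement r.1 r.2 k l) *
          Complex.exp (2 * (((r.1 : ℤ) - p.1 : ℤ) : ℂ) * Complex.I * φ) := by
    intro φ
    rw [integral_hermiteIntegrand, Finset.mul_sum]
    refine Finset.sum_congr rfl fun r hr => ?_
    have hr' : (r.1 : ℂ) + r.2 = p.1 + p.2 := by
      exact_mod_cast Finset.HasAntidiagonal.mem_antidiagonal.1 hr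
    have h2 : Complex.exp (2 * (((r.1 : ℤ) - p.1 : ℤ) : ℂ) * Complex.I * φ) =
        Complex.exp (Complex.I * φ * ((p.2 : ℂ) - p.1)) *
          Complex.exp (Complex.I * φ * ((r.1 : ℂ) - r.2)) := by
      rw [← Complex.exp_add]
      congr 1
      push_cast
      linear_combination (Complex.I * φ) * hr'
    rw [h2, traceCoeff]
    ring
  simp_rw [e]
  rw [intervalIntegral.integral_finsetSum fun r _ =>
    Continuous.intervalIntegrable (by fun_prop) 0 Real.pi]
  simp_rw [intervalIntegral.integral_const_mul, integral_exp_two_mul_int]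
  rw [Finset.sum_eq_single p]
  · have h1 : ((p.1 + p.2).choose p.1 : ℂ) ≠ 0 := by
      exact_mod_cast (Nat.choose_pos (Nat.le_add_right p.1 p.2)).ne'
    rw [sub_self, if_pos rfl]
    field_simp
  · intro r hr hrp
    rw [if_neg, mul_zero]
    intro h
    apply hrp
    have := Finset.HasAntidiagonal.mem_antidiagonal.1 hr
    ext <;> omega
  · intro h
    exact absurd (Finset.HasAntidiagonal.mem_antidiagonal.2 rfl) h

/-- The bound on each term does not involve `φ`. The series of continuous functions therefore
converges uniformly, and its sum is continuous and integrable term by term. -/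
theorem integral_spectralForm_phaseSeries {c : ℕ → ℕ → ℂ}
    (hs : Summable (fun p : ℕ × ℕ => ‖c p.1 p.2‖ *
      (((p.1 + p.2).choose p.1 : ℝ)⁻¹ * Real.sqrt (p.1 + p.2).factorial))) (k l : ℕ) :
    IntervalIntegrable (fun φ : ℝ => spectralForm φ (kernelTransform
      (phaseSeries (traceCoeff c φ))) (fockKet k) (fockKet l)) volume 0 Real.pi ∧
    HasSum (fun p : ℕ × ℕ => Real.pi * (c p.1 p.2 * monomialElement p.1 p.2 k l))
      (∫ φ in (0 : ℝ)..Real.pi, spectralForm φ (kernelTransform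
        (phaseSeries (traceCoeff c φ))) (fockKet k) (fockKet l)) := by
  set term : ℕ × ℕ → ℝ → ℂ := fun p φ =>
    traceCoeff c φ p * ∫ ξ, hermiteIntegrand φ (p.1 + p.2) k l ξ with hterm
  have hsum : ∀ φ : ℝ, HasSum (fun p => term p φ) (spectralForm φ (kernelTransform
      (phaseSeries (traceCoeff c φ))) (fockKet k) (fockKet l)) := fun φ =>
    (spectralForm_phaseSeries (summable_traceCoeff hs φ) φ k l).2
  have hcont : ∀ p, Continuous (term p) := by
    intro p
    simp only [hterm, traceCoeff, integral_hermiteIntegrand]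
    fun_prop
  have hbound : ∀ p φ, ‖term p φ‖ ≤ ‖c p.1 p.2‖ *
      (((p.1 + p.2).choose p.1 : ℝ)⁻¹ * Real.sqrt (p.1 + p.2).factorial) * wickBound k l := by
    intro p φ
    rw [hterm, norm_mul, norm_traceCoeff]
    refine (mul_le_mul_of_nonneg_left ((norm_integral_le_integral_norm _).trans
      (integral_norm_hermiteIntegrand_le φ (p.1 + p.2) k l)) (by positivity)).trans (le_of_eq ?_)
    ring
  have hu := hs.mul_right (wickBound k l)
  have hc : Continuous (fun φ : ℝ => spectralForm φ (kernelTransform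
      (phaseSeries (traceCoeff c φ))) (fockKet k) (fockKet l)) := by
    rw [funext fun φ => (hsum φ).tsum_eq.symm]
    exact continuous_tsum hcont hu hbound
  refine ⟨hc.intervalIntegrable 0 Real.pi, ?_⟩
  have h := intervalIntegral.hasSum_integral_of_dominated_convergence (μ := volume) (a := 0)
    (b := Real.pi) (F := term) (fun p _ => ‖c p.1 p.2‖ *
      (((p.1 + p.2).choose p.1 : ℝ)⁻¹ * Real.sqrt (p.1 + p.2).factorial) * wickBound k l)
    (fun p => (hcont p).aestronglyMeasurable)
    (fun p => Filter.Eventually.of_forall fun φ _ => hbound p φ)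
    (Filter.Eventually.of_forall fun φ _ => hu) intervalIntegrable_const
    (Filter.Eventually.of_forall fun φ _ => hsum φ)
  simpa only [hterm, integral_traceCoeff_mul] using h

/-! ### Assembly of the expansion -/

theorem isQuadratureExpansion_phaseSeries (X : Hilb →ₗ.[ℂ] Hilb) (hX : DefinedOnFock X)
    {c : ℕ → ℕ → ℂ} (hc : HasNormalOrderedForm X hX c)
    (hs : Summable (fun p : ℕ × ℕ => ‖c p.1 p.2‖ *
      (((p.1 + p.2).choose p.1 : ℝ)⁻¹ * Real.sqrt (p.1 + p.2).factorial))) :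
    IsQuadratureExpansion (fun φ => phaseSeries (traceCoeff c φ)) X hX := by
  refine ⟨fun φ x => integrable_phaseSeries_mul_gaussKernel (summable_traceCoeff hs φ) x,
    fun φ R v hv => exists_integral_opF hv
      (integrable_phaseSeries_mul_gaussKernel (summable_traceCoeff hs φ) 0),
    fun k l => ⟨fun φ => (spectralForm_phaseSeries (summable_traceCoeff hs φ) φ k l).1,
      (integral_spectralForm_phaseSeries hs k l).1, ?_⟩⟩
  have h : HasSum (fun p : ℕ × ℕ => Real.pi * (c p.1 p.2 * monomialElement p.1 p.2 k l))
      (Real.pi * inner ℂ (fockKet k) (X ⟨fockKet l, hX l⟩) : ℂ) := (hc k l).mul_left _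
  have hpi : (Real.pi : ℂ) ≠ 0 := by exact_mod_cast Real.pi_ne_zero
  rw [(integral_spectralForm_phaseSeries hs k l).2.unique h]
  field_simp

end Quadrature

open Quadrature in
theorem mainTheorem1 :
    -- the operators `G(t,φ)` are well defined
    (∀ φ t : ℝ, IntervalIntegrable (coherentDyad φ t) volume 0 1) ∧
    (∀ φ : ℝ, Differentiable ℝ (primitiveG φ)) ∧
    -- the normal-ordered monomials
    (∀ m n : ℕ,
      (∀ φ t : ℝ, HasSum
        (traceTerm (opG t φ) (normalMonomial m n) (definedOnFock_normalMonomial m n))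
        (deriv (fun s : ℝ => (s : ℂ) * ∫ θ in (0 : ℝ)..1,
          (-Complex.I * θ * s * Complex.exp (Complex.I * φ)) ^ n *
          (-Complex.I * (1 - θ) * s * Complex.exp (-(Complex.I * φ))) ^ m) t)) ∧
      IsQuadratureExpansion
        (fun φ t => deriv (fun s : ℝ => (s : ℂ) * ∫ θ in (0 : ℝ)..1,
          (-Complex.I * θ * s * Complex.exp (Complex.I * φ)) ^ n *
          (-Complex.I * (1 - θ) * s * Complex.exp (-(Complex.I * φ))) ^ m) t)
        (normalMonomial m n) (definedOnFock_normalMonomial m n)) ∧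
    -- the operators with a normal-ordered form
    (∀ (X : Hilb →ₗ.[ℂ] Hilb) (hX : DefinedOnFock X) (c : ℕ → ℕ → ℂ),
      HasNormalOrderedForm X hX c →
      Summable (fun p : ℕ × ℕ => ‖c p.1 p.2‖ *
        (((p.1 + p.2).choose p.1 : ℝ)⁻¹ * Real.sqrt (p.1 + p.2).factorial)) →
      (∀ φ t : ℝ, Summable (traceTerm (opG t φ) X hX)) ∧
      IsQuadratureExpansion (fun φ t => traceAdj (opG t φ) X hX) X hX ∧
      (∀ k l : ℕ,
        inner ℂ (fockKet k) (X ⟨fockKet l, hX l⟩) =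
          (1 / Real.pi : ℂ) * ∫ φ in (0 : ℝ)..Real.pi,
            spectralForm φ (fun x => dualPairing φ x X hX) (fockKet k) (fockKet l))) := by
  refine ⟨intervalIntegrable_coherentDyad, differentiable_primitiveG, fun m n => ?_,
    fun X hX c hc hs => ?_⟩
  · have hc := hasNormalOrderedForm_normalMonomial m n
    have hs := summable_single_coeff m n
    have ht := hasSum_traceTerm _ (definedOnFock_normalMonomial m n) hc hs
    have he := isQuadratureExpansion_phaseSeries _ (definedOnFock_normalMonomial m n) hc hs
    -- The single-coefficient series is the closed form of the bracket's derivative.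
    have e : (fun φ => phaseSeries (traceCoeff
        (fun m' q' => if (m', q') = (m, n) then 1 else 0) φ)) = fun φ t => monomialCoeff m n φ t := by
      funext φ t
      rw [← tsum_mul_monomialCoeff, tsum_single_coeff]
    rw [e] at he
    simp_rw [tsum_single_coeff] at ht
    simp_rw [deriv_bracket]
    exact ⟨ht, he⟩
  · have ht := hasSum_traceTerm X hX hc hs
    have he := isQuadratureExpansion_phaseSeries X hX hc hs
    have e : (fun φ => phaseSeries (traceCoeff c φ)) = fun φ t => traceAdj (opG t φ) X hX := by
      funext φ t
      rw [← tsum_mul_monomialCoeff, traceAdj, (ht φ t).tsum_eq]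
    rw [e] at he
    refine ⟨fun φ t => (ht φ t).summable, he, fun k l => ?_⟩
    -- The dual pairing is the function `f_φ` of the expansion, so the duality is its matrix-element
    -- clause.
    have hd : ∀ φ, (fun x => dualPairing φ x X hX) =
        kernelTransform fun t => traceAdj (opG t φ) X hX := by
      intro φ
      funext x
      rw [dualPairing, kernelTransform]
      simp_rw [mul_comm]
    simp_rw [hd]
    exact (he.2.2 k l).2.2
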